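/- Let $R$ be a commutative ring with identity and let $\mathrm{Ch}(R)$ be the category of ($\mathbb{Z}$-indexed) complexes of $R$-modules. Let $C$ be a semidualizing $R$-module, that is: $C$ has a projective resolution by finitely generated projective modules, the homothety map $R\to \mathrm{Hom}_R(C,C)$ is an isomorphism, and $\mathrm{Ext}_R^{i}(C,C)=0$ for all $i\ge 1$. Let $\mathcal{P}(R)$ be the class of projective $R$-modules, and let $\mathcal{P}_C(R)$ and $\mathcal{F}_C(R)$ be the classes of modules isomorphic to $C\otimes_R P$ with $P$ projective, respectively to $C\otimes_R F$ with $F$ flat. For a class $\mathcal{X}$ of modules let $\widetilde{\mathcal{X}}$ be the class of exact complexes all of whose cycle modules lie in $\mathcal{X}$. A complex $X$ is called $D_C$-projective if there is an exact sequence of complexes $$\cdots\to P_1\to P_0\xrightarrow{f_0}Q_{-1}\to Q_{-2}\to\cdots$$ with all $P_i\in\widetilde{\mathcal{P}(R)}$ and all $Q_i\in\widetilde{\mathcal{P}_C(R)}$, which remains exact after applying $\mathrm{Hom}_{\mathrm{Ch}(R)}(-,H)$ for every $H\in\widetilde{\mathcal{F}_C(R)}$, such that $X\cong\mathrm{Im}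 f_0$. The $D_C$-projective dimension $D_C\text{-pd}(X)$ of a complex $X$ is the least integer $n\ge 0$ for which there is an exact sequence $0\to G_n\to\cdots\to G_0\to X\to 0$ in $\mathrm{Ch}(R)$ with all $G_i$ $D_C$-projective, and $D_C\text{-pd}(X)=\infty$ if there is no such $n$. Corollary 3.4. Let $0\to X\to Y\to Z\to 0$ be an exact sequence in $\mathrm{Ch}(R)$. Then the following hold. 1. For every integer $n\ge 0$, if $D_C\text{-pd}(Z)\le n$, then $D_C\text{-pd}(X)\le n$ if and only if $D_C\text{-pd}(Y)\le n$. Consequently, $D_C\text{-pd}(X)\le\max\{D_C\text{-pd}(Y),D_C\text{-pd}(Z)\}$ and $D_C\text{-pd}(Y)\le\max\{D_C\text{-pd}(X),D_C\text{-pd}(Z)\}$. 2. If $D_C\text{-pd}(X)>D_C\text{-pd}(Z)$ or $D_C\text{-pd}(Y)>D_C\text{-pd}(Z)$, then $D_C\text{-pd}(X)=D_C\text{-pd}(Y)$. 3. If $D_C\text{-pd}(Z)>0$ and $Y$ is $D_C$-projective, then $D_C\text{-pd}(X)=D_C\text{-pd}(Z)-1$ (where $\infty-1=\infty$). In particular,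 if two of the complexes $X$, $Y$, $Z$ have finite $D_C$-projective dimension, then so does the third. -/

import Mathlib

open CategoryTheory CategoryTheory.Limits

universe u v w

namespace DingC

section Abstract

variable {A : Type w} [Category.{v} A] [Abelian A]

/-- A complex `L` (for instance a sequence indexed by `ℤ`) in an abelian category is
`Hom(-, B)`-exact if `Hom(L, T)` is an exact complex of abelian groups for every `T` in the class
`B`: every `g : L_i ⟶ T` which vanishes on composition with the differential into `L_i` factors
through the differential out of `L_i`. -/
def IsHomExact (L : ChainComplex A ℤ) (B : ObjectProperty A) : Prop :=
  ∀ T : A, B T → ∀ (i : ℤ) (g : L.X i ⟶ T), L.d (i + 1) i ≫ g = 0 →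
    ∃ h : L.X (i - 1) ⟶ T, L.d i (i - 1) ≫ h = g

/-- There is an exact sequence `0 ⟶ G_n ⟶ ⋯ ⟶ G_0 ⟶ X ⟶ 0` with all `G_i` in the class `P`.
It is encoded as an exact complex `L` with `L_0 ≅ X`, `L_{i+1} = G_i` for `0 ≤ i ≤ n`
and `L_{i+1} = 0` for `i > n`. -/
def HasResolutionOfLength (P : ObjectProperty A) (n : ℕ) (X : A) : Prop :=
  ∃ L : ChainComplex A ℕ, L.Acyclic ∧ Nonempty (L.X 0 ≅ X) ∧
    (∀ i : ℕ, i ≤ n → P (L.X (i + 1))) ∧ (∀ i : ℕ, n < i → IsZero (L.X (i + 1)))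

end Abstract

variable {R : Type u} [CommRing R]

/-- `Ch(R)`: the category of `ℤ`-indexed complexes of `R`-modules, with differentials of
degree `-1`. -/
abbrev Ch (R : Type u) [CommRing R] : Type (u + 1) := ChainComplex (ModuleCat.{u} R) ℤ

/-- A semidualizing `R`-module. -/
structure IsSemidualizing (C : ModuleCat.{u} R) : Prop where
  /-- `C` has a projective resolution by finitely generated modules -/
  finite_resolution : ∃ P : ProjectiveResolution C, ∀ n : ℕ, Module.Finite R (P.complex.X n)
  /-- the homothety map `R → Hom_R(C, C)` is an isomorphism -/
  homothety : Function.Bijective (LinearMap.lsmul R C)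
  /-- `Ext^n_R(C, C) = 0` for all `n ≥ 1` -/
  ext_eq_zero : ∀ n : ℕ, 1 ≤ n → Subsingleton (Abelian.Ext.{u} C C n)

/-- The class `𝒫(R)` of projective modules. -/
def projectiveModules (R : Type u) [CommRing R] : ObjectProperty (ModuleCat.{u} R) :=
  fun M => Module.Projective R M

/-- The class `𝒫_C(R)` of `C`-projective modules, i.e. of modules isomorphic to `C ⊗ P`
with `P` projective. -/
def cProjectiveModules (C : ModuleCat.{u} R) : ObjectProperty (ModuleCat.{u} R) :=
  fun M => ∃ P : ModuleCat.{u} R, Module.Projective R P ∧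
    Nonempty (M ≃ₗ[R] TensorProduct R C P)

/-- The class `ℱ_C(R)` of `C`-flat modules, i.e. of modules isomorphic to `C ⊗ F`
with `F` flat. -/
def cFlatModules (C : ModuleCat.{u} R) : ObjectProperty (ModuleCat.{u} R) :=
  fun M => ∃ F : ModuleCat.{u} R, Module.Flat R F ∧
    Nonempty (M ≃ₗ[R] TensorProduct R C F)

/-- For a class `𝒳` of modules, the class of `𝒳`-complexes: the exact complexes all of whose
cycle modules lie in `𝒳`. -/
def tilde (𝒳 : ObjectProperty (ModuleCat.{u} R)) : ObjectProperty (Ch R) :=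
  fun X => X.Acyclic ∧ ∀ i : ℤ, 𝒳 (X.cycles i)

/-- The class of `D_C`-projective complexes. The sequence
`⋯ ⟶ P_1 ⟶ P_0 ⟶ Q_{-1} ⟶ Q_{-2} ⟶ ⋯` of complexes is `L`, with `P_i = L_i` for `i ≥ 0` and
`Q_i = L_i` for `i < 0`. -/
def dcProjective (C : ModuleCat.{u} R) : ObjectProperty (Ch R) :=
  fun X => ∃ L : ChainComplex (Ch R) ℤ,
    L.Acyclic ∧ IsHomExact L (tilde (cFlatModules C)) ∧
    (∀ i : ℤ, 0 ≤ i → tilde (projectiveModules R) (L.X i)) ∧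
    (∀ i : ℤ, i < 0 → tilde (cProjectiveModules C) (L.X i)) ∧
    Nonempty (X ≅ image (L.d 0 (-1)))

/-- The `D_C`-projective dimension of a complex: the least `n` such that the complex has a
resolution of length `n` by `D_C`-projective complexes, and `∞` if there is no such `n`. -/
noncomputable def dcPd (C : ModuleCat.{u} R) (X : Ch R) : ℕ∞ :=
  ⨅ (n : ℕ) (_ : HasResolutionOfLength (dcProjective C) n X), (n : ℕ∞)

end DingC

/-!
Let `ℋ` be the class of `ℱ_C`-complexes. A complex is `D_C`-projective if and only if it lies in
`⊥ℋ = {X | Ext^n(X, T) = 0 for all T ∈ ℋ and n ≥ 1}` and has a coresolution by `𝒫_C`-complexes all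
of whose cosyzygies lie in `⊥ℋ`: the left half of a complete resolution can then be added freely,
because projective objects have such coresolutions themselves. To see this, split an exact complex
with projective cycles into a direct sum of disks; this reduces the question to a projective module
`Z ≅ Hom(C, C) ⊗ Z`, which is coresolved by applying `Hom(-, C) ⊗ Z` to a resolution of `C` by
finitely generated projective modules. The cosyzygies are of the form `Hom(M, C) ⊗ Z`, with `M` a
syzygy of `C`, and their `Ext` groups into `C ⊗ F` vanish because
`M ⊗ F ≅ Hom(Hom(M, C), C ⊗ F)` is inherited by syzygies.

Coresolutions of this kind are compatible with extensions and kernels of epimorphisms, so the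
`D_C`-projective complexes form a resolving class, and the inequalities between the dimensions hold
for every resolving class by dimension shifting.
-/

open scoped ZeroObject

namespace DingC

section ShortExact

variable {A : Type w} [Category.{v} A] [Abelian A]

lemma shortExact_kernel {Y Z : A} (p : Y ⟶ Z) [Epi p] :
    (ShortComplex.mk (kernel.ι p) p (kernel.condition p)).ShortExact where
  exact := ShortComplex.exact_kernel p

lemma shortExact_cokernel {X Y : A} (i : X ⟶ Y) [Mono i] :
    (ShortComplex.mk i (cokernel.π i) (cokernel.condition i)).ShortExact where
  exact := ShortComplex.exact_cokernel i

lemma shortExact_biprod (X Z : A) :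
    (ShortComplex.mk (biprod.inl : X ⟶ X ⊞ Z) biprod.snd (by simp)).ShortExact :=
  (ShortComplex.Splitting.ofHasBinaryBiproduct X Z).shortExact

lemma shortExact_id_of_isZero {X : A} (Z : A) (hX : IsZero X) :
    (ShortComplex.mk (0 : X ⟶ Z) (𝟙 Z) (by simp)).ShortExact where
  exact := (ShortComplex.exact_iff_mono _ rfl).2 inferInstance
  mono_f := hX.mono _

lemma shortExact_of_isIso_of_isZero {X Y Z : A} (f : X ⟶ Y) [IsIso f] (hZ : IsZero Z) :
    (ShortComplex.mk f (0 : Y ⟶ Z) (by simp)).ShortExact where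
  exact := (ShortComplex.exact_iff_epi _ rfl).2 inferInstance
  epi_g := hZ.epi _

lemma shortExact_of_isPullback {S : ShortComplex A} (hS : S.ShortExact) {E W : A} {k : S.X₁ ⟶ E}
    {a : E ⟶ S.X₂} {b : E ⟶ W} {q : W ⟶ S.X₃} (sq : IsPullback a b S.g q) (hka : k ≫ a = S.f)
    (hkb : k ≫ b = 0) : (ShortComplex.mk k b hkb).ShortExact := by
  have := hS.mono_f
  have := hS.epi_g
  have : Mono k := mono_of_mono_fac hka
  have : Epi b := Abelian.epi_snd_of_isLimit S.g q sq.isLimit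
  refine .mk' (ShortComplex.exact_of_f_is_kernel _
    (KernelFork.IsLimit.ofι' _ _ fun {T} x hx => ?_)) ‹_› ‹_›
  have hxa : (x ≫ a) ≫ S.g = 0 := by
    rw [Category.assoc, sq.w, reassoc_of% (show x ≫ b = 0 from hx), zero_comp]
  exact ⟨hS.exact.lift (x ≫ a) hxa,
    sq.hom_ext (by simp [hka]) (by simpa [hkb] using hx.symm)⟩

lemma shortExact_of_isPushout {S : ShortComplex A} (hS : S.ShortExact) {E V : A} {k : E ⟶ S.X₃}
    {j : S.X₁ ⟶ V} {c : V ⟶ E} {b : S.X₂ ⟶ E} (sq : IsPushout S.f j b c) (hbk : b ≫ k = S.g)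
    (hck : c ≫ k = 0) : (ShortComplex.mk c k hck).ShortExact :=
  (shortExact_of_isPullback (S := S.op) (k := k.op) (a := b.op) (b := c.op) hS.op sq.op.flip
    (congrArg Quiver.Hom.op hbk) (congrArg Quiver.Hom.op hck)).unop

lemma shortExact_comp_of_isPushout {S : ShortComplex A} (hS : S.ShortExact) {V W : A}
    {j : S.X₂ ⟶ V} [Mono j] {c : S.X₃ ⟶ W} {b : V ⟶ W} (sq : IsPushout j S.g b c) :
    (ShortComplex.mk (S.f ≫ j) b (by simp [sq.w])).ShortExact := by
  have := hS.mono_f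
  have := hS.epi_g
  have : Epi b := sq.epi_inl_of_epi
  refine .mk' (ShortComplex.exact_of_g_is_cokernel _
    (CokernelCofork.IsColimit.ofπ' _ _ fun {T} x hx => ?_)) (mono_comp _ _) ‹_›
  have hxj : S.f ≫ j ≫ x = 0 := by simpa using hx
  exact ⟨sq.desc x (hS.exact.desc (j ≫ x) hxj) (by simp), by simp⟩

lemma shortExact_X₁_of_shortExact {E : ShortComplex (ShortComplex A)} (hE : E.ShortExact)
    (h₂ : E.X₂.ShortExact) (h₃ : E.X₃.ShortExact) : E.X₁.ShortExact := by
  have := hE.epi_g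
  let D : ShortComplex.SnakeInput A :=
    { L₀ := E.X₁
      L₁ := E.X₂
      L₂ := E.X₃
      L₃ := 0
      v₀₁ := E.f
      v₁₂ := E.g
      v₂₃ := 0
      h₀ := hE.fIsKernel
      h₃ := CokernelCofork.IsColimit.ofEpiOfIsZero _ hE.epi_g (isZero_zero _)
      L₁_exact := h₂.exact
      L₂_exact := h₃.exact
      epi_L₁_g := h₂.epi_g
      mono_L₂_f := h₃.mono_f}
  have := h₂.mono_f
  exact .mk' D.L₀_exact D.mono_L₀_f
    (D.L₁'_exact.epi_f ((ShortComplex.π₁.map_isZero (isZero_zero _)).eq_of_tgt _ _))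

lemma shortExact_X₃_of_shortExact {E : ShortComplex (ShortComplex A)} (hE : E.ShortExact)
    (h₁ : E.X₁.ShortExact) (h₂ : E.X₂.ShortExact) : E.X₃.ShortExact := by
  have := hE.mono_f
  let D : ShortComplex.SnakeInput A :=
    { L₀ := 0
      L₁ := E.X₁
      L₂ := E.X₂
      L₃ := E.X₃
      v₀₁ := 0
      v₁₂ := E.f
      v₂₃ := E.g
      h₀ := KernelFork.IsLimit.ofMonoOfIsZero _ hE.mono_f (isZero_zero _)
      h₃ := hE.gIsCokernel
      L₁_exact := h₁.exact
      L₂_exact := h₂.exact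
      epi_L₁_g := h₁.epi_g
      mono_L₂_f := h₂.mono_f}
  have := h₂.epi_g
  exact .mk' D.L₃_exact
    (D.L₂'_exact.mono_g ((ShortComplex.π₃.map_isZero (isZero_zero _)).eq_of_src _ _))
    D.epi_L₃_g

end ShortExact

section Syzygy

variable {A : Type w} [Category.{v} A] [Abelian A]

/-- `K` is a syzygy of `X` with respect to the class `P`: there is a short exact sequence
`0 ⟶ K ⟶ E ⟶ X ⟶ 0` with `E` in `P`. -/
def IsSyzygy (P : ObjectProperty A) (K X : A) : Prop :=
  ∃ (E : A) (i : K ⟶ E) (p : E ⟶ X) (w : i ≫ p = 0), (ShortComplex.mk i p w).ShortExact ∧ P E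

variable {P : ObjectProperty A}

lemma isSyzygy_of_shortExact {S : ShortComplex A} (hS : S.ShortExact) (h : P S.X₂) :
    IsSyzygy P S.X₁ S.X₃ :=
  ⟨S.X₂, S.f, S.g, S.zero, hS, h⟩

namespace IsSyzygy

lemma congr {K K' X X' : A} (h : IsSyzygy P K X) (e : K ≅ K') (e' : X ≅ X') :
    IsSyzygy P K' X' := by
  obtain ⟨E, i, p, w, hS, hE⟩ := h
  exact ⟨E, e.inv ≫ i, p ≫ e'.hom, by simp [reassoc_of% w],
    ShortComplex.shortExact_of_iso (ShortComplex.isoMk e (Iso.refl E) e') hS, hE⟩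

lemma of_iso_left {K K' X : A} (h : IsSyzygy P K X) (e : K ≅ K') : IsSyzygy P K' X :=
  h.congr e (Iso.refl X)

lemma of_iso_right {K X X' : A} (h : IsSyzygy P K X) (e : X ≅ X') : IsSyzygy P K X' :=
  h.congr (Iso.refl K) e

end IsSyzygy

lemma exists_shortExact_syzygies {F S : ShortComplex A} (φ : F ⟶ S) [Epi φ.τ₁] [Epi φ.τ₃]
    (hF : F.ShortExact) (hS : S.ShortExact) (h₁ : P F.X₁) (h₂ : P F.X₂) (h₃ : P F.X₃) :
    ∃ K : ShortComplex A, K.ShortExact ∧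
      IsSyzygy P K.X₁ S.X₁ ∧ IsSyzygy P K.X₂ S.X₂ ∧ IsSyzygy P K.X₃ S.X₃ := by
  have := hF.epi_g
  have := hS.epi_g
  have := ShortComplex.epi_τ₂_of_exact_of_epi φ hS.exact
  have : Epi φ := ⟨fun a b h => by
    ext
    exacts [(cancel_epi φ.τ₁).1 (congrArg ShortComplex.Hom.τ₁ h),
      (cancel_epi φ.τ₂).1 (congrArg ShortComplex.Hom.τ₂ h),
      (cancel_epi φ.τ₃).1 (congrArg ShortComplex.Hom.τ₃ h)]⟩
  have hφ := shortExact_kernel φ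
  exact ⟨kernel φ, shortExact_X₁_of_shortExact hφ hF hS,
    isSyzygy_of_shortExact (hφ.map_of_exact ShortComplex.π₁) h₁,
    isSyzygy_of_shortExact (hφ.map_of_exact ShortComplex.π₂) h₂,
    isSyzygy_of_shortExact (hφ.map_of_exact ShortComplex.π₃) h₃⟩

lemma exists_shortExact_cosyzygies {S F : ShortComplex A} (φ : S ⟶ F) (hS : S.ShortExact)
    (hF : F.ShortExact) (h₂ : P F.X₂) {Y₁ Y₃ : A} {q₁ : F.X₁ ⟶ Y₁} {q₃ : F.X₃ ⟶ Y₃}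
    {w₁ : φ.τ₁ ≫ q₁ = 0} {w₃ : φ.τ₃ ≫ q₃ = 0} (hY₁ : (ShortComplex.mk φ.τ₁ q₁ w₁).ShortExact)
    (hY₃ : (ShortComplex.mk φ.τ₃ q₃ w₃).ShortExact) :
    ∃ K : ShortComplex A, K.ShortExact ∧
      Nonempty (Y₁ ≅ K.X₁) ∧ IsSyzygy P S.X₂ K.X₂ ∧ Nonempty (Y₃ ≅ K.X₃) := by
  have := hS.mono_f
  have := hF.mono_f
  have : Mono φ.τ₁ := hY₁.mono_f
  have : Mono φ.τ₃ := hY₃.mono_f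
  have := ShortComplex.mono_τ₂_of_exact_of_mono φ hS.exact
  have : Mono φ := ⟨fun a b h => by
    ext
    exacts [(cancel_mono φ.τ₁).1 (congrArg ShortComplex.Hom.τ₁ h),
      (cancel_mono φ.τ₂).1 (congrArg ShortComplex.Hom.τ₂ h),
      (cancel_mono φ.τ₃).1 (congrArg ShortComplex.Hom.τ₃ h)]⟩
  have hφ := shortExact_cokernel φ
  exact ⟨cokernel φ, shortExact_X₃_of_shortExact hφ hS hF,
    ⟨hY₁.gIsCokernel.coconePointUniqueUpToIso
      (hφ.map_of_exact ShortComplex.π₁).gIsCokernel⟩,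
    isSyzygy_of_shortExact (hφ.map_of_exact ShortComplex.π₂) h₂,
    ⟨hY₃.gIsCokernel.coconePointUniqueUpToIso
      (hφ.map_of_exact ShortComplex.π₃).gIsCokernel⟩⟩

end Syzygy

section ExtVanishing

universe t

variable {A : Type w} [Category.{v} A] [Abelian A] [HasExt.{t} A]

/-- `Ext^n(X, T) = 0` for all `n ≥ 1`; the condition is indexed by `n - 1`. -/
def ExtVanishing (X T : A) : Prop := ∀ n : ℕ, Subsingleton (Abelian.Ext.{t} X T (n + 1))

open Abelian.Ext hiding comp_zero zero_comp

namespace ExtVanishing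

variable {X Y T : A} {S : ShortComplex A}

lemma of_projective (P : A) [Projective P] (T : A) : ExtVanishing P T := fun n =>
  subsingleton_of_projective P T n

lemma of_iso (h : ExtVanishing X T) (e : X ≅ Y) : ExtVanishing Y T := fun n =>
  @Equiv.subsingleton _ _
    (((Abelian.extFunctor (n + 1)).mapIso e.op).app T).addCommGroupIsoToAddEquiv.toEquiv (h n)

lemma of_iso_right (h : ExtVanishing X T) {T' : A} (e : T ≅ T') : ExtVanishing X T' := fun n =>
  @Equiv.subsingleton _ _
    ((Abelian.extFunctorObj X (n + 1)).mapIso e.symm).addCommGroupIsoToAddEquiv.toEquiv (h n)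

lemma X₂_of_shortExact (hS : S.ShortExact) (h₁ : ExtVanishing S.X₁ T)
    (h₃ : ExtVanishing S.X₃ T) : ExtVanishing S.X₂ T := fun n => by
  refine subsingleton_of_forall_eq 0 fun a => ?_
  obtain ⟨b, rfl⟩ := contravariant_sequence_exact₂ hS T a ((h₁ n).elim _ _)
  rw [(h₃ n).elim b 0, Abelian.Ext.comp_zero]

lemma X₂_of_shortExact_right (hS : S.ShortExact) (h₁ : ExtVanishing T S.X₁)
    (h₃ : ExtVanishing T S.X₃) : ExtVanishing T S.X₂ := fun n => by
  refine subsingleton_of_forall_eq 0 fun a => ?_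
  obtain ⟨b, rfl⟩ := covariant_sequence_exact₂ T hS a ((h₃ n).elim _ _)
  rw [(h₁ n).elim b 0, Abelian.Ext.zero_comp]

lemma X₁_of_shortExact (hS : S.ShortExact) (h₂ : ExtVanishing S.X₂ T)
    (h₃ : ExtVanishing S.X₃ T) : ExtVanishing S.X₁ T := fun n => by
  refine subsingleton_of_forall_eq 0 fun a => ?_
  obtain ⟨b, rfl⟩ := contravariant_sequence_exact₁ hS T a (add_comm 1 (n + 1))
    ((h₃ (n + 1)).elim _ _)
  rw [(h₂ n).elim b 0, Abelian.Ext.comp_zero]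

lemma exists_f_comp_eq (hS : S.ShortExact) (h₃ : ExtVanishing S.X₃ T) (φ : S.X₁ ⟶ T) :
    ∃ ψ : S.X₂ ⟶ T, S.f ≫ ψ = φ := by
  obtain ⟨b, hb⟩ := contravariant_sequence_exact₁ hS T (mk₀ φ) (add_comm 1 0) ((h₃ 0).elim _ _)
  obtain ⟨ψ, rfl⟩ := (mk₀_bijective S.X₂ T).2 b
  refine ⟨ψ, (mk₀_bijective S.X₁ T).1 ?_⟩
  rw [← hb, mk₀_comp_mk₀]

lemma subsingleton_ext_one (hS : S.ShortExact) (h₂ : ExtVanishing S.X₂ T)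
    (hf : ∀ φ : S.X₁ ⟶ T, ∃ ψ : S.X₂ ⟶ T, S.f ≫ ψ = φ) :
    Subsingleton (Abelian.Ext.{t} S.X₃ T 1) := by
  refine subsingleton_of_forall_eq 0 fun a => ?_
  obtain ⟨b, rfl⟩ := contravariant_sequence_exact₃ hS T a ((h₂ 0).elim _ _) (add_comm 1 0)
  obtain ⟨φ, rfl⟩ := (mk₀_bijective S.X₁ T).2 b
  obtain ⟨ψ, rfl⟩ := hf φ
  rw [← mk₀_comp_mk₀]
  exact hS.extClass_comp_assoc (mk₀ ψ)

lemma subsingleton_ext_add_two (hS : S.ShortExact) (h₂ : ExtVanishing S.X₂ T) {n : ℕ}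
    (h₁ : Subsingleton (Abelian.Ext.{t} S.X₁ T (n + 1))) :
    Subsingleton (Abelian.Ext.{t} S.X₃ T (n + 2)) := by
  refine subsingleton_of_forall_eq 0 fun a => ?_
  obtain ⟨b, rfl⟩ := contravariant_sequence_exact₃ hS T a ((h₂ (n + 1)).elim _ _)
    (add_comm 1 (n + 1))
  rw [h₁.elim b 0, Abelian.Ext.comp_zero]

lemma X₃_of_shortExact (hS : S.ShortExact) (h₁ : ExtVanishing S.X₁ T)
    (h₂ : ExtVanishing S.X₂ T) (hf : ∀ φ : S.X₁ ⟶ T, ∃ ψ : S.X₂ ⟶ T, S.f ≫ ψ = φ) :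
    ExtVanishing S.X₃ T
  | 0 => subsingleton_ext_one hS h₂ hf
  | n + 1 => subsingleton_ext_add_two hS h₂ (h₁ n)

lemma of_syzygies (𝒮 : ObjectProperty A)
    (h : ∀ X, 𝒮 X → ∃ (K E : A) (i : K ⟶ E) (p : E ⟶ X) (w : i ≫ p = 0),
      (ShortComplex.mk i p w).ShortExact ∧ ExtVanishing E T ∧ 𝒮 K ∧
        ∀ φ : K ⟶ T, ∃ ψ : E ⟶ T, i ≫ ψ = φ)
    {X : A} (hX : 𝒮 X) : ExtVanishing X T := fun n => by
  induction n generalizing X with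
  | zero =>
    obtain ⟨K, E, i, p, w, hS, hE, -, hi⟩ := h X hX
    exact subsingleton_ext_one hS hE hi
  | succ n ih =>
    obtain ⟨K, E, i, p, w, hS, hE, hK, -⟩ := h X hX
    exact subsingleton_ext_add_two hS hE (ih hK)

end ExtVanishing

/-- The left orthogonal of `H`: the class of objects `X` with `Ext^n(X, T) = 0` for all `n ≥ 1` and
all `T` in `H`. -/
def leftPerp (H : ObjectProperty A) : ObjectProperty A := fun X => ∀ T, H T → ExtVanishing X T

/-- The largest subclass of `leftPerp H` every member of which embeds into an object of `Q` with
cokernel in the subclass. Iterating, its members are those with a coresolution by objects of `Q`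
all of whose cosyzygies lie in `leftPerp H`. -/
def Coresolved (Q H : ObjectProperty A) : ObjectProperty A := fun X =>
  ∃ 𝒮 : ObjectProperty A, 𝒮 X ∧ ∀ Y, 𝒮 Y → leftPerp H Y ∧ ∃ Y', IsSyzygy Q Y Y' ∧ 𝒮 Y'

namespace Coresolved

variable {Q H : ObjectProperty A} {X Y : A} {S : ShortComplex A}

lemma leftPerp (h : Coresolved Q H X) : leftPerp H X := by
  obtain ⟨𝒮, hX, h𝒮⟩ := h
  exact (h𝒮 X hX).1

lemma exists_cosyzygy (h : Coresolved Q H X) : ∃ Y, IsSyzygy Q X Y ∧ Coresolved Q H Y := by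
  obtain ⟨𝒮, hX, h𝒮⟩ := h
  obtain ⟨-, Y, hXY, hY⟩ := h𝒮 X hX
  exact ⟨Y, hXY, 𝒮, hY, h𝒮⟩

lemma of_isSyzygy (hXY : IsSyzygy Q X Y) (hX : DingC.leftPerp H X) (hY : Coresolved Q H Y) :
    Coresolved Q H X := by
  obtain ⟨𝒮, hY, h𝒮⟩ := hY
  refine ⟨fun W => W = X ∨ 𝒮 W, Or.inl rfl, ?_⟩
  rintro W (rfl | hW)
  · exact ⟨hX, Y, hXY, Or.inr hY⟩
  · obtain ⟨hW', Y', hWY', hY'⟩ := h𝒮 W hW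
    exact ⟨hW', Y', hWY', Or.inr hY'⟩

lemma of_iso (h : Coresolved Q H X) (e : X ≅ Y) : Coresolved Q H Y := by
  obtain ⟨Z, hXZ, hZ⟩ := h.exists_cosyzygy
  exact of_isSyzygy (hXZ.of_iso_left e) (fun T hT => (h.leftPerp T hT).of_iso e) hZ

lemma exists_shortExact_cosyzygies (hQH : Q ≤ H) (hQ : ∀ E E', Q E → Q E' → Q (E ⊞ E'))
    (hS : S.ShortExact) (h₁ : Coresolved Q H S.X₁) (h₃ : Coresolved Q H S.X₃) :
    ∃ K : ShortComplex A, K.ShortExact ∧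
      Coresolved Q H K.X₁ ∧ IsSyzygy Q S.X₂ K.X₂ ∧ Coresolved Q H K.X₃ := by
  obtain ⟨Y₁, ⟨E, j, q, w, hj, hE⟩, hY₁⟩ := h₁.exists_cosyzygy
  obtain ⟨Y₃, ⟨E', j', q', w', hj', hE'⟩, hY₃⟩ := h₃.exists_cosyzygy
  obtain ⟨l, hl⟩ := ExtVanishing.exists_f_comp_eq hS (h₃.leftPerp E (hQH E hE)) j
  let φ : S ⟶ ShortComplex.mk (biprod.inl : E ⟶ E ⊞ E') biprod.snd (by simp) :=
    { τ₁ := j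
      τ₂ := biprod.lift l (S.g ≫ j')
      τ₃ := j'
      comm₁₂ := by ext <;> simp [hl] }
  obtain ⟨K, hK, ⟨e₁⟩, h₂, ⟨e₃⟩⟩ := DingC.exists_shortExact_cosyzygies (P := Q) φ hS
    (shortExact_biprod E E') (hQ E E' hE hE') hj hj'
  exact ⟨K, hK, hY₁.of_iso e₁, h₂, hY₃.of_iso e₃⟩

lemma X₂_of_shortExact (hQH : Q ≤ H) (hQ : ∀ E E', Q E → Q E' → Q (E ⊞ E'))
    (hS : S.ShortExact) (h₁ : Coresolved Q H S.X₁) (h₃ : Coresolved Q H S.X₃) :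
    Coresolved Q H S.X₂ := by
  refine ⟨fun Y => ∃ S : ShortComplex A, S.ShortExact ∧ S.X₂ = Y ∧ Coresolved Q H S.X₁ ∧
    Coresolved Q H S.X₃, ⟨S, hS, rfl, h₁, h₃⟩, ?_⟩
  rintro _ ⟨S, hS, rfl, h₁, h₃⟩
  obtain ⟨K, hK, hK₁, h₂, hK₃⟩ := exists_shortExact_cosyzygies hQH hQ hS h₁ h₃
  exact ⟨fun T hT => .X₂_of_shortExact hS (h₁.leftPerp T hT) (h₃.leftPerp T hT),
    K.X₂, h₂, K, hK, rfl, hK₁, hK₃⟩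

lemma X₁_of_shortExact (hQH : Q ≤ H) (hQ : ∀ E E', Q E → Q E' → Q (E ⊞ E'))
    (hS : S.ShortExact) (h₂ : Coresolved Q H S.X₂) (h₃ : Coresolved Q H S.X₃) :
    Coresolved Q H S.X₁ := by
  obtain ⟨Y, ⟨E, j, q, w, hj, hE⟩, hY⟩ := h₂.exists_cosyzygy
  have : Mono j := hj.mono_f
  have sq := IsPushout.of_hasPushout j S.g
  have hW := shortExact_of_isPushout hj sq (sq.inl_desc q 0 (by simpa using w))
    (sq.inr_desc q 0 (by simpa using w))
  exact of_isSyzygy ⟨E, _, _, _, shortExact_comp_of_isPushout hS sq, hE⟩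
    (fun T hT => .X₁_of_shortExact hS (h₂.leftPerp T hT) (h₃.leftPerp T hT))
    (X₂_of_shortExact hQH hQ hW h₃ hY)

end Coresolved

end ExtVanishing

section Splice

variable {A : Type w} [Category.{v} A] [Abelian A]

lemma exact_iff_of_epi_mono_fac {X' X Y Z Z' : A} {f' : X' ⟶ Y} {g' : Y ⟶ Z'} {w' : f' ≫ g' = 0}
    {f : X ⟶ Y} {g : Y ⟶ Z} {w : f ≫ g = 0} {p : X' ⟶ X} {j : Z ⟶ Z'} [Epi p] [Mono j]
    (hf : p ≫ f = f') (hg : g ≫ j = g') :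
    (ShortComplex.mk f' g' w').Exact ↔ (ShortComplex.mk f g w).Exact := by
  let φ : ShortComplex.mk f' g (by rw [← hf, Category.assoc, w, comp_zero]) ⟶
      ShortComplex.mk f g w :=
    { τ₁ := p
      τ₂ := 𝟙 Y
      τ₃ := 𝟙 Z }
  let ψ : ShortComplex.mk f' g (by rw [← hf, Category.assoc, w, comp_zero]) ⟶
      ShortComplex.mk f' g' w' :=
    { τ₁ := 𝟙 X'
      τ₂ := 𝟙 Y
      τ₃ := j }
  have : Epi φ.τ₁ := ‹Epi p›
  have : Mono ψ.τ₃ := ‹Mono j›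
  have : Epi ψ.τ₁ := inferInstanceAs (Epi (𝟙 _))
  have : IsIso φ.τ₂ := inferInstanceAs (IsIso (𝟙 _))
  have : IsIso ψ.τ₂ := inferInstanceAs (IsIso (𝟙 _))
  have : Mono φ.τ₃ := inferInstanceAs (Mono (𝟙 _))
  rw [← ShortComplex.exact_iff_of_epi_of_isIso_of_mono ψ,
    ShortComplex.exact_iff_of_epi_of_isIso_of_mono φ]

lemma image_ι_comp_factorThruImage (S : ShortComplex A) :
    Abelian.image.ι S.f ≫ Abelian.factorThruImage S.g = 0 := by
  simp [← cancel_epi (Abelian.factorThruImage S.f), ← cancel_mono (Abelian.image.ι S.g)]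

lemma shortExact_image {S : ShortComplex A} (hS : S.Exact) :
    (ShortComplex.mk _ _ (image_ι_comp_factorThruImage S)).ShortExact where
  exact := (exact_iff_of_epi_mono_fac (Abelian.image.fac S.f) (Abelian.image.fac S.g)).1 hS

variable {α : Type*} [AddRightCancelSemigroup α] [One α] [DecidableEq α]
  {Z L : α → A} {ι : ∀ i, Z (i + 1) ⟶ L i} {π : ∀ i, L i ⟶ Z i} {w : ∀ i, ι i ≫ π i = 0}

/-- The complex with differentials `L (i + 1) ⟶ Z (i + 1) ⟶ L i` obtained by splicing sequences
`0 ⟶ Z (i + 1) ⟶ L i ⟶ Z i ⟶ 0`. -/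
noncomputable abbrev splice (w : ∀ i, ι i ≫ π i = 0) : ChainComplex A α :=
  ChainComplex.of L (fun i => π (i + 1) ≫ ι i) fun i => by simp [reassoc_of% w (i + 1)]

lemma splice_d (i : α) : (splice w).d (i + 1) i = π (i + 1) ≫ ι i :=
  ChainComplex.of_d (V := A) L (fun i => π (i + 1) ≫ ι i) i

lemma exactAt_splice (h : ∀ i, (ShortComplex.mk (ι i) (π i) (w i)).ShortExact) (i : α) :
    (splice w).ExactAt (i + 1) := by
  have : Mono (ι i) := (h i).mono_f
  have : Epi (π (i + 1 + 1)) := (h (i + 1 + 1)).epi_g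
  rw [HomologicalComplex.exactAt_iff' _ (i + 1 + 1) (i + 1) i (by simp)
    (ComplexShape.next_eq' _ rfl)]
  exact (exact_iff_of_epi_mono_fac (splice_d (w := w) (i + 1)).symm
    (splice_d (w := w) i).symm).2 (h (i + 1)).exact

end Splice

section Resolution

variable {A : Type w} [Category.{v} A] [Abelian A] {D : ObjectProperty A} {n : ℕ} {X : A}

lemma hasResolutionOfLength_of_isSyzygy {Z : ℕ → A} (e : Z 0 ≅ X)
    (hZ : ∀ i ≤ n, IsSyzygy D (Z (i + 1)) (Z i)) (hZ' : ∀ i > n, IsZero (Z i)) :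
    HasResolutionOfLength D n X := by
  -- The augmented resolution starts with `Z 0` in degree `0`, whose cokernel is `0`.
  let Z' : ℕ → A := fun i => i.casesOn 0 Z
  let P : ℕ → ObjectProperty A := fun i => i.casesOn (fun E => Nonempty (E ≅ Z 0))
    fun i E => (i ≤ n → D E) ∧ (n < i → IsZero E)
  have key (i : ℕ) : IsSyzygy (P i) (Z' (i + 1)) (Z' i) := by
    rcases i with _ | i
    · exact isSyzygy_of_shortExact (shortExact_of_isIso_of_isZero (𝟙 (Z 0)) (isZero_zero A))
        ⟨Iso.refl _⟩
    · rcases le_or_gt i n with hi | hi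
      · obtain ⟨E, j, p, w, hS, hE⟩ := hZ i hi
        exact ⟨E, j, p, w, hS, fun _ => hE, fun h => absurd h hi.not_gt⟩
      · exact isSyzygy_of_shortExact (shortExact_id_of_isZero (Z i) (hZ' (i + 1) (by omega)))
          ⟨fun h => absurd h hi.not_ge, fun _ => hZ' i hi⟩
  choose L ι π w hS hL using key
  have hι : Epi (ι 0) := (hS 0).exact.epi_f ((isZero_zero A).eq_of_tgt _ _)
  have hπ : Epi (π 1) := (hS 1).epi_g
  refine ⟨splice w, ?_, ⟨(hL 0).some ≪≫ e⟩, fun i => (hL (i + 1)).1, fun i => (hL (i + 1)).2⟩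
  rintro (_ | i)
  · rw [HomologicalComplex.exactAt_iff' _ (0 + 1) 0 0 (by simp) (by simp)]
    refine (ShortComplex.exact_iff_epi _ ((splice w).shape 0 0 (by simp))).2 ?_
    change Epi ((splice w).d (0 + 1) 0)
    rw [splice_d]
    exact epi_comp' hπ hι
  · exact exactAt_splice hS i

lemma exists_isSyzygy_of_hasResolutionOfLength (h : HasResolutionOfLength D n X) :
    ∃ Z : ℕ → A, Nonempty (Z 0 ≅ X) ∧ (∀ i ≤ n, IsSyzygy D (Z (i + 1)) (Z i)) ∧
      ∀ i > n, IsZero (Z i) := by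
  obtain ⟨L, hL, ⟨e⟩, hLD, hL0⟩ := h
  have : Epi (L.d 1 0) := ((HomologicalComplex.exactAt_iff' L 1 0 0 (by simp) (by simp)).1
    (hL 0)).epi_f (L.shape 0 0 (by simp))
  refine ⟨fun i => Abelian.image (L.d (i + 1) i), ⟨asIso (Abelian.image.ι (L.d 1 0)) ≪≫ e⟩,
    fun i hi => ?_, fun i hi => (hL0 i hi).of_epi (Abelian.factorThruImage _)⟩
  exact isSyzygy_of_shortExact (shortExact_image
    ((HomologicalComplex.exactAt_iff' L (i + 2) (i + 1) i (by simp) (by simp)).1 (hL (i + 1))))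
    (hLD i hi)

end Resolution

section Dimension

variable {A : Type w} [Category.{v} A] [Abelian A]

/-- The class of objects of `D`-resolution dimension at most `n`, in terms of iterated syzygies:
`X` has a `D`-syzygy of dimension at most `n - 1`, and lies in `D` if `n = 0`. -/
def HasDim (D : ObjectProperty A) : ℕ → ObjectProperty A
  | 0 => D
  | n + 1 => fun X => ∃ K, IsSyzygy D K X ∧ HasDim D n K

lemma exists_isSyzygy_of_hasDim {D : ObjectProperty A} {n : ℕ} {X : A} (h : HasDim D n X) :
    ∃ Z : ℕ → A, Z 0 = X ∧ (∀ i ≤ n, IsSyzygy D (Z (i + 1)) (Z i)) ∧ ∀ i > n, IsZero (Z i) := by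
  induction n generalizing X with
  | zero =>
    refine ⟨fun i => i.casesOn X fun _ => 0, rfl, fun i hi => ?_, ?_⟩
    · obtain rfl : i = 0 := by omega
      exact isSyzygy_of_shortExact (shortExact_id_of_isZero X (isZero_zero A)) h
    · rintro (_ | i) hi
      exacts [absurd hi (lt_irrefl 0), isZero_zero A]
  | succ n ih =>
    obtain ⟨_, hK, hK'⟩ := h
    obtain ⟨Z, rfl, hZ, hZ'⟩ := ih hK'
    refine ⟨fun i => i.casesOn X Z, rfl, ?_, ?_⟩
    · rintro (_ | i) hi
      exacts [hK, hZ i (by omega)]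
    · rintro (_ | i) hi
      exacts [absurd hi (Nat.not_lt_zero _), hZ' i (by omega)]

/-- A resolving class: a class of objects closed under extensions and kernels of epimorphisms which
contains enough projective objects. -/
structure IsResolving (D : ObjectProperty A) : Prop where
  X₂_of_shortExact {S : ShortComplex A} : S.ShortExact → D S.X₁ → D S.X₃ → D S.X₂
  X₁_of_shortExact {S : ShortComplex A} : S.ShortExact → D S.X₂ → D S.X₃ → D S.X₁
  exists_projective (X : A) : ∃ (P : A) (p : P ⟶ X), Projective P ∧ D P ∧ Epi p

namespace IsResolving

variable {D : ObjectProperty A} (hD : IsResolving D) {X Y : A} {S : ShortComplex A} {n : ℕ}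

include hD

lemma of_isZero (hX : IsZero X) : D X := by
  obtain ⟨P, -, -, hP, -⟩ := hD.exists_projective X
  exact hD.X₁_of_shortExact (shortExact_id_of_isZero P hX) hP hP

lemma of_iso (e : X ≅ Y) (h : D X) : D Y :=
  hD.X₁_of_shortExact (shortExact_of_isIso_of_isZero e.inv (isZero_zero A)) h
    (hD.of_isZero (isZero_zero A))

lemma hasDim_of_iso (e : X ≅ Y) (h : HasDim D n X) : HasDim D n Y := by
  cases n with
  | zero => exact hD.of_iso e h
  | succ n =>
    obtain ⟨K, hK, hK'⟩ := h
    exact ⟨K, hK.of_iso_right e, hK'⟩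

lemma hasDim_of_mem (h : D X) : HasDim D n X := by
  induction n generalizing X with
  | zero => exact h
  | succ n ih =>
    exact ⟨0, isSyzygy_of_shortExact (shortExact_id_of_isZero X (isZero_zero A)) h,
      ih (hD.of_isZero (isZero_zero A))⟩

lemma hasDim_succ (h : HasDim D n X) : HasDim D (n + 1) X := by
  induction n generalizing X with
  | zero => exact hD.hasDim_of_mem h
  | succ n ih =>
    obtain ⟨K, hK, hK'⟩ := h
    exact ⟨K, hK, ih hK'⟩

lemma hasDim_mono {m : ℕ} (hmn : m ≤ n) (h : HasDim D m X) : HasDim D n X := by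
  induction n, hmn using Nat.le_induction with
  | base => exact h
  | succ n _ ih => exact hD.hasDim_succ ih

lemma hasDim_of_isSyzygy {Z : ℕ → A} (hZ : ∀ i ≤ n, IsSyzygy D (Z (i + 1)) (Z i))
    (hZ' : IsZero (Z (n + 1))) : HasDim D n (Z 0) := by
  induction n generalizing Z with
  | zero =>
    obtain ⟨E, i, p, w, hS, hE⟩ := hZ 0 le_rfl
    have : IsIso p := hS.isIso_g_iff.2 hZ'
    exact hD.of_iso (asIso p) hE
  | succ n ih =>
    exact ⟨Z 1, hZ 0 n.succ.zero_le,
      ih (Z := fun i => Z (i + 1)) (fun i hi => hZ (i + 1) (by omega)) hZ'⟩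

lemma hasResolutionOfLength_iff_hasDim : HasResolutionOfLength D n X ↔ HasDim D n X := by
  refine ⟨fun h => ?_, fun h => ?_⟩
  · obtain ⟨Z, ⟨e⟩, hZ, hZ'⟩ := exists_isSyzygy_of_hasResolutionOfLength h
    exact hD.hasDim_of_iso e (hD.hasDim_of_isSyzygy hZ (hZ' (n + 1) n.lt_succ_self))
  · obtain ⟨Z, rfl, hZ, hZ'⟩ := exists_isSyzygy_of_hasDim h
    exact hasResolutionOfLength_of_isSyzygy (Iso.refl _) hZ hZ'

lemma exists_shortExact_syzygies (hS : S.ShortExact) : ∃ K : ShortComplex A, K.ShortExact ∧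
    IsSyzygy D K.X₁ S.X₁ ∧ IsSyzygy D K.X₂ S.X₂ ∧ IsSyzygy D K.X₃ S.X₃ := by
  obtain ⟨P₁, p₁, -, hP₁, _⟩ := hD.exists_projective S.X₁
  obtain ⟨P₃, p₃, _, hP₃, _⟩ := hD.exists_projective S.X₃
  have := hS.epi_g
  let φ : ShortComplex.mk (biprod.inl : P₁ ⟶ P₁ ⊞ P₃) biprod.snd (by simp) ⟶ S :=
    { τ₁ := p₁
      τ₂ := biprod.desc (p₁ ≫ S.f) (Projective.factorThru p₃ S.g)
      τ₃ := p₃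
      comm₂₃ := by ext <;> simp }
  have : Epi φ.τ₁ := ‹_›
  have : Epi φ.τ₃ := ‹_›
  exact DingC.exists_shortExact_syzygies φ (shortExact_biprod P₁ P₃) hS hP₁
    (hD.X₂_of_shortExact (shortExact_biprod P₁ P₃) hP₁ hP₃) hP₃

lemma hasDim_X₁_of_forall_iff
    (hn : ∀ S : ShortComplex A, S.ShortExact → HasDim D n S.X₃ →
      (HasDim D n S.X₁ ↔ HasDim D n S.X₂))
    (hS : S.ShortExact) (h₂ : D S.X₂) (h₃ : HasDim D (n + 1) S.X₃) : HasDim D n S.X₁ := by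
  obtain ⟨K, ⟨G, j, q, w, hj, hG⟩, hK⟩ := h₃
  have sq := IsPullback.of_hasPullback S.g q
  have hk := shortExact_of_isPullback hS sq (sq.lift_fst S.f 0 (by simp))
    (sq.lift_snd S.f 0 (by simp))
  have hl := shortExact_of_isPullback hj sq.flip (sq.lift_snd 0 j (by simpa using w.symm))
    (sq.lift_fst 0 j (by simpa using w.symm))
  exact (hn _ hk (hD.hasDim_of_mem hG)).2 ((hn _ hl (hD.hasDim_of_mem h₂)).1 hK)

lemma hasDim_X₁_iff_hasDim_X₂ (hS : S.ShortExact) (h₃ : HasDim D n S.X₃) :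
    HasDim D n S.X₁ ↔ HasDim D n S.X₂ := by
  induction n generalizing S with
  | zero => exact ⟨fun h₁ => hD.X₂_of_shortExact hS h₁ h₃,
      fun h₂ => hD.X₁_of_shortExact hS h₂ h₃⟩
  | succ n ih =>
    have syz {K X : A} : IsSyzygy D K X → HasDim D (n + 1) X → HasDim D n K :=
      fun ⟨E, i, p, w, h, hE⟩ => hD.hasDim_X₁_of_forall_iff (fun S hS => ih hS) h hE
    obtain ⟨K, hK, h₁, h₂, hK₃⟩ := hD.exists_shortExact_syzygies hS
    have key := ih hK (syz hK₃ h₃)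
    exact ⟨fun h => ⟨_, h₂, key.1 (syz h₁ h)⟩, fun h => ⟨_, h₁, key.2 (syz h₂ h)⟩⟩

lemma hasDim_succ_iff {K X : A} (h : IsSyzygy D K X) :
    HasDim D (n + 1) X ↔ HasDim D n K := by
  refine ⟨fun hX => ?_, fun hK => ⟨K, h, hK⟩⟩
  obtain ⟨E, i, p, w, hS, hE⟩ := h
  exact hD.hasDim_X₁_of_forall_iff (fun S hS => hD.hasDim_X₁_iff_hasDim_X₂ hS) hS hE hX

lemma hasDim_succ_X₃ (hS : S.ShortExact) (h₁ : HasDim D n S.X₁) (h₂ : HasDim D n S.X₂) :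
    HasDim D (n + 1) S.X₃ := by
  induction n generalizing S with
  | zero => exact ⟨S.X₁, isSyzygy_of_shortExact hS h₂, h₁⟩
  | succ n ih =>
    obtain ⟨K, hK, hK₁, hK₂, hK₃⟩ := hD.exists_shortExact_syzygies hS
    exact ⟨K.X₃, hK₃, ih hK ((hD.hasDim_succ_iff hK₁).1 h₁) ((hD.hasDim_succ_iff hK₂).1 h₂)⟩

end IsResolving

/-- The `D`-resolution dimension of an object: the least length of a resolution by objects of `D`,
and `⊤` if there is none. -/
noncomputable def resolutionDim (D : ObjectProperty A) (X : A) : ℕ∞ :=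
  ⨅ (n : ℕ) (_ : HasResolutionOfLength D n X), (n : ℕ∞)

namespace IsResolving

variable {D : ObjectProperty A} (hD : IsResolving D) {X : A} {S : ShortComplex A} {n : ℕ}

include hD

lemma resolutionDim_le_iff : resolutionDim D X ≤ n ↔ HasDim D n X := by
  refine ⟨fun h => ?_, fun h => iInf₂_le n (hD.hasResolutionOfLength_iff_hasDim.2 h)⟩
  have hlt : resolutionDim D X < (n + 1 : ℕ) := h.trans_lt (by exact_mod_cast n.lt_succ_self)
  simp only [resolutionDim, iInf_lt_iff, Nat.cast_lt] at hlt
  obtain ⟨m, hm, hmn⟩ := hlt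
  exact hD.hasDim_mono (Nat.lt_succ_iff.1 hmn) (hD.hasResolutionOfLength_iff_hasDim.1 hm)

lemma resolutionDim_X₁_le_iff (hS : S.ShortExact) (h₃ : resolutionDim D S.X₃ ≤ n) :
    resolutionDim D S.X₁ ≤ n ↔ resolutionDim D S.X₂ ≤ n := by
  rw [hD.resolutionDim_le_iff] at *
  rw [hD.resolutionDim_le_iff, hD.hasDim_X₁_iff_hasDim_X₂ hS h₃]

lemma resolutionDim_X₁_le_max (hS : S.ShortExact) :
    resolutionDim D S.X₁ ≤ max (resolutionDim D S.X₂) (resolutionDim D S.X₃) := by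
  refine le_of_forall_ge fun m hm => ?_
  induction m with
  | top => exact le_top
  | coe n =>
    exact (hD.resolutionDim_X₁_le_iff hS ((le_max_right _ _).trans hm)).2
      ((le_max_left _ _).trans hm)

lemma resolutionDim_X₂_le_max (hS : S.ShortExact) :
    resolutionDim D S.X₂ ≤ max (resolutionDim D S.X₁) (resolutionDim D S.X₃) := by
  refine le_of_forall_ge fun m hm => ?_
  induction m with
  | top => exact le_top
  | coe n =>
    exact (hD.resolutionDim_X₁_le_iff hS ((le_max_right _ _).trans hm)).1
      ((le_max_left _ _).trans hm)

lemma resolutionDim_X₁_eq_X₂ (hS : S.ShortExact)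
    (h : resolutionDim D S.X₃ < resolutionDim D S.X₁ ∨
      resolutionDim D S.X₃ < resolutionDim D S.X₂) :
    resolutionDim D S.X₁ = resolutionDim D S.X₂ := by
  have h₁ := hD.resolutionDim_X₁_le_max hS
  have h₂ := hD.resolutionDim_X₂_le_max hS
  rcases h with h | h
  · have h₁₂ := (le_max_iff.1 h₁).resolve_right h.not_ge
    exact h₁₂.antisymm (h₂.trans (max_le le_rfl h.le))
  · have h₂₁ := (le_max_iff.1 h₂).resolve_right h.not_ge
    exact (h₁.trans (max_le le_rfl h.le)).antisymm h₂₁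

lemma resolutionDim_X₁_eq_sub_one (hS : S.ShortExact) (h₂ : D S.X₂) :
    resolutionDim D S.X₁ = resolutionDim D S.X₃ - 1 := by
  refine eq_of_forall_ge_iff fun m => ?_
  induction m with
  | top => simp
  | coe n =>
    rw [tsub_le_iff_right, ← Nat.cast_add_one, hD.resolutionDim_le_iff, hD.resolutionDim_le_iff,
      hD.hasDim_succ_iff (isSyzygy_of_shortExact hS h₂)]

lemma resolutionDim_X₃_lt_top (hS : S.ShortExact) (h₁ : resolutionDim D S.X₁ < ⊤)
    (h₂ : resolutionDim D S.X₂ < ⊤) : resolutionDim D S.X₃ < ⊤ := by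
  obtain ⟨n, hn⟩ := ENat.ne_top_iff_exists.1 (max_lt h₁ h₂).ne
  have h₁' := hD.resolutionDim_le_iff.1 ((le_max_left _ _).trans hn.ge)
  have h₂' := hD.resolutionDim_le_iff.1 ((le_max_right _ _).trans hn.ge)
  exact (hD.resolutionDim_le_iff.2 (hD.hasDim_succ_X₃ hS h₁' h₂')).trans_lt (ENat.natCast_lt_top _)

end IsResolving

end Dimension

section CompleteResolution

universe t

lemma exists_int_chain {α : Type*} {r s : α → α → Prop} (hr : ∀ a, ∃ b, r b a)
    (hs : ∀ a, ∃ b, s a b) (x : α) :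
    ∃ z : ℤ → α, z 0 = x ∧ (∀ i, 0 ≤ i → r (z (i + 1)) (z i)) ∧
      ∀ i, i < 0 → s (z (i + 1)) (z i) := by
  choose down hdown using hr
  choose up hup using hs
  let z : ℤ → α
    | Int.ofNat n => down^[n] x
    | Int.negSucc n => up^[n + 1] x
  refine ⟨z, rfl, ?_, ?_⟩
  · rintro (n | n) hn
    · change r (down^[n + 1] x) (down^[n] x)
      rw [Function.iterate_succ_apply']
      exact hdown _
    · exact absurd hn (by simp)
  · rintro (n | n) hn
    · exact absurd hn (by simp)
    · have hz : z (Int.negSucc n + 1) = up^[n] x := by cases n <;> rfl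
      change s _ (up^[n + 1] x)
      rw [hz, Function.iterate_succ_apply']
      exact hup _

variable {A : Type w} [Category.{v} A] [Abelian A]

lemma isHomExact_iff (L : ChainComplex A ℤ) (B : ObjectProperty A) :
    IsHomExact L B ↔ ∀ T, B T → ∀ (k : ℤ) (g : L.X (k + 1) ⟶ T),
      L.d (k + 1 + 1) (k + 1) ≫ g = 0 → ∃ h : L.X k ⟶ T, L.d (k + 1) k ≫ h = g := by
  refine forall₂_congr fun T _ => ((Equiv.addRight (1 : ℤ)).forall_congr fun k => ?_).symm
  rw [Equiv.coe_addRight, add_sub_cancel_right]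

lemma isHomExact_splice {Z L : ℤ → A} {ι : ∀ i, Z (i + 1) ⟶ L i} {π : ∀ i, L i ⟶ Z i}
    {w : ∀ i, ι i ≫ π i = 0} (h : ∀ i, (ShortComplex.mk (ι i) (π i) (w i)).ShortExact)
    {B : ObjectProperty A}
    (hB : ∀ T, B T → ∀ i (φ : Z (i + 1) ⟶ T), ∃ ψ : L i ⟶ T, ι i ≫ ψ = φ) :
    IsHomExact (splice w) B := by
  refine (isHomExact_iff _ _).2 fun T hT k g hg => ?_
  have : Epi (π (k + 1 + 1)) := (h (k + 1 + 1)).epi_g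
  have := (h (k + 1)).epi_g
  rw [splice_d, Category.assoc] at hg
  obtain ⟨ψ, hψ⟩ := hB T hT k ((h (k + 1)).exact.desc g (zero_of_epi_comp _ hg))
  refine ⟨ψ, ?_⟩
  rw [splice_d, Category.assoc, hψ]
  exact (h (k + 1)).exact.g_desc _ _

lemma nonempty_iso_image_splice {Z L : ℤ → A} {ι : ∀ i, Z (i + 1) ⟶ L i} {π : ∀ i, L i ⟶ Z i}
    {w : ∀ i, ι i ≫ π i = 0} (h : ∀ i, (ShortComplex.mk (ι i) (π i) (w i)).ShortExact) {i j : ℤ}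
    (hij : j + 1 = i) : Nonempty (Z i ≅ image ((splice w).d i j)) := by
  subst hij
  have : Epi (π (j + 1)) := (h (j + 1)).epi_g
  have : Mono (ι j) := (h j).mono_f
  have := strongEpi_of_epi (π (j + 1))
  exact ⟨image.isoStrongEpiMono (π (j + 1)) (ι j) (splice_d (w := w) j).symm⟩

lemma shortExact_image_d {L : ChainComplex A ℤ} (hL : L.Acyclic) (k : ℤ) :
    (ShortComplex.mk (Abelian.image.ι (L.d (k + 1 + 1) (k + 1)))
      (Abelian.factorThruImage (L.d (k + 1) k))
      (image_ι_comp_factorThruImage (L.sc' (k + 1 + 1) (k + 1) k))).ShortExact :=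
  shortExact_image ((HomologicalComplex.exactAt_iff' L (k + 1 + 1) (k + 1) k (by simp)
    (by simp)).1 (hL (k + 1)))

/-- The class of images of the differentials `L_0 ⟶ L_{-1}` of the `Hom(-, H)`-exact acyclic
complexes `L` with components in `P` in nonnegative degrees and in `Q` in negative degrees. The
`D_C`-projective complexes are an instance by definition. -/
def HasCompleteResolution (P Q H : ObjectProperty A) : ObjectProperty A := fun X =>
  ∃ L : ChainComplex A ℤ, L.Acyclic ∧ IsHomExact L H ∧ (∀ i : ℤ, 0 ≤ i → P (L.X i)) ∧
    (∀ i : ℤ, i < 0 → Q (L.X i)) ∧ Nonempty (X ≅ image (L.d 0 (-1)))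

variable [HasExt.{t} A] {P Q H : ObjectProperty A}

lemma leftPerp_image_of_isHomExact {L : ChainComplex A ℤ} (hL : L.Acyclic) (hLH : IsHomExact L H)
    (h : ∀ i, leftPerp H (L.X i)) (k : ℤ) : leftPerp H (Abelian.image (L.d (k + 1) k)) := by
  intro T hT
  refine ExtVanishing.of_syzygies (fun Y => ∃ k, Y = Abelian.image (L.d (k + 1) k)) ?_ ⟨k, rfl⟩
  rintro _ ⟨k, rfl⟩
  refine ⟨_, _, _, _, _, shortExact_image_d hL k, h _ T hT, ⟨k + 1, rfl⟩, fun φ => ?_⟩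
  have hφ : L.d (k + 1 + 1 + 1) (k + 1 + 1) ≫ Abelian.factorThruImage _ ≫ φ = 0 := by
    have hw : Abelian.image.ι (L.d (k + 1 + 1 + 1) (k + 1 + 1)) ≫
        Abelian.factorThruImage (L.d (k + 1 + 1) (k + 1)) = 0 :=
      image_ι_comp_factorThruImage (L.sc' (k + 1 + 1 + 1) (k + 1 + 1) (k + 1))
    rw [← Abelian.image.fac (L.d (k + 1 + 1 + 1) (k + 1 + 1)), Category.assoc,
      reassoc_of% hw, zero_comp, comp_zero]
  obtain ⟨ψ, hψ⟩ := (isHomExact_iff L H).1 hLH T hT (k + 1) _ hφ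
  exact ⟨ψ, by rw [← cancel_epi (Abelian.factorThruImage _), ← hψ, ← Category.assoc,
    Abelian.image.fac]⟩

lemma coresolved_of_hasCompleteResolution (hPH : P ≤ leftPerp H) (hQH : Q ≤ leftPerp H) {X : A}
    (hX : HasCompleteResolution P Q H X) : Coresolved Q H X := by
  obtain ⟨L, hL, hLH, hP, hQ, ⟨e⟩⟩ := hX
  have hperp (i : ℤ) : leftPerp H (L.X i) := (lt_or_ge i 0).elim
    (fun hi => hQH _ (hQ i hi)) fun hi => hPH _ (hP i hi)
  refine ⟨fun Y => ∃ k < 0, Nonempty (Y ≅ Abelian.image (L.d (k + 1) k)),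
    ⟨-1, by norm_num, ⟨e ≪≫ (Abelian.imageIsoImage _).symm⟩⟩, ?_⟩
  rintro Y ⟨k, hk, ⟨e⟩⟩
  refine ⟨fun T hT => (leftPerp_image_of_isHomExact hL hLH hperp k T hT).of_iso e.symm, ?_⟩
  obtain ⟨l, rfl⟩ : ∃ l, k = l + 1 := ⟨k - 1, by omega⟩
  exact ⟨_, (isSyzygy_of_shortExact (shortExact_image_d hL l) (hQ _ hk)).of_iso_left e.symm,
    l, by omega, ⟨Iso.refl _⟩⟩

lemma hasCompleteResolution_of_coresolved
    (hP : ∀ X : A, ∃ (E : A) (p : E ⟶ X), P E ∧ Epi p) (hQH : Q ≤ H)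
    (hQ : ∀ E E', Q E → Q E' → Q (E ⊞ E')) (hPQ : P ≤ Coresolved Q H) {X : A}
    (hX : Coresolved Q H X) : HasCompleteResolution P Q H X := by
  have hdown (Y : Subtype (Coresolved Q H)) :
      ∃ K : Subtype (Coresolved Q H), IsSyzygy P K.1 Y.1 := by
    obtain ⟨E, p, hE, _⟩ := hP Y
    have hp := shortExact_kernel p
    exact ⟨⟨kernel p, .X₁_of_shortExact hQH hQ hp (hPQ E hE) Y.2⟩, isSyzygy_of_shortExact hp hE⟩
  have hup (Y : Subtype (Coresolved Q H)) :
      ∃ K : Subtype (Coresolved Q H), IsSyzygy Q Y.1 K.1 := by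
    obtain ⟨K, hYK, hK⟩ := Y.2.exists_cosyzygy
    exact ⟨⟨K, hK⟩, hYK⟩
  obtain ⟨Z, hZ, hdown, hup⟩ := exists_int_chain hdown hup ⟨X, hX⟩
  have key (i : ℤ) : IsSyzygy (fun E => (0 ≤ i → P E) ∧ (i < 0 → Q E)) (Z (i + 1)).1 (Z i).1 := by
    rcases le_or_gt 0 i with hi | hi
    · obtain ⟨E, j, p, w, hS, hE⟩ := hdown i hi
      exact ⟨E, j, p, w, hS, fun _ => hE, fun h => absurd h hi.not_gt⟩
    · obtain ⟨E, j, p, w, hS, hE⟩ := hup i hi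
      exact ⟨E, j, p, w, hS, fun h => absurd h hi.not_ge, fun _ => hE⟩
  choose L ι π w hS hL using key
  refine ⟨splice w, fun i => ?_, isHomExact_splice hS fun T hT i φ =>
    ExtVanishing.exists_f_comp_eq (hS i) ((Z i).2.leftPerp T hT) φ, fun i => (hL i).1,
    fun i => (hL i).2, ⟨eqToIso (congrArg Subtype.val hZ).symm ≪≫
      (nonempty_iso_image_splice (Z := fun i => (Z i).1) (w := w) hS (neg_add_cancel 1)).some⟩⟩
  obtain ⟨n, rfl⟩ : ∃ n, i = n + 1 := ⟨i - 1, by omega⟩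
  exact exactAt_splice hS n

end CompleteResolution

section Disks

universe t t'

variable {A : Type w} [Category.{v} A] [Abelian A]

lemma shortExact_biprodMap {S S' : ShortComplex A} (hS : S.ShortExact) (hS' : S'.ShortExact) :
    (ShortComplex.mk (biprod.map S.f S'.f) (biprod.map S.g S'.g)
      (by ext <;> simp)).ShortExact := by
  have := hS.mono_f
  have := hS'.mono_f
  have := hS.epi_g
  have := hS'.epi_g
  refine .mk' (ShortComplex.exact_of_f_is_kernel _
    (KernelFork.IsLimit.ofι' _ _ fun {T} x hx => ?_)) inferInstance inferInstance
  have hx₁ : (x ≫ biprod.fst) ≫ S.g = 0 := by simpa using hx =≫ biprod.fst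
  have hx₂ : (x ≫ biprod.snd) ≫ S'.g = 0 := by simpa using hx =≫ biprod.snd
  exact ⟨biprod.lift (hS.exact.lift _ hx₁) (hS'.exact.lift _ hx₂), by ext <;> simp⟩

lemma isIso_biprod_desc {S : ShortComplex A} (hS : S.ShortExact) {s : S.X₃ ⟶ S.X₂}
    (hs : s ≫ S.g = 𝟙 S.X₃) : IsIso (biprod.desc s S.f) := by
  let σ := ShortComplex.Splitting.ofExactOfSection S hS.exact s hs hS.mono_f
  refine ⟨biprod.lift S.g σ.r, ?_, ?_⟩
  · ext <;> simp [hs, show s ≫ σ.r = 0 from σ.s_r]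
  · rw [biprod.lift_desc, add_comm]
    exact σ.id

lemma nonempty_cycles_splice_iso {Z L : ℤ → A} {ι : ∀ i, Z (i + 1) ⟶ L i} {π : ∀ i, L i ⟶ Z i}
    {w : ∀ i, ι i ≫ π i = 0} (h : ∀ i, (ShortComplex.mk (ι i) (π i) (w i)).ShortExact) (i : ℤ) :
    Nonempty ((splice w).cycles i ≅ Z (i + 1)) := by
  obtain ⟨j, rfl⟩ : ∃ j, i = j + 1 := ⟨i - 1, by omega⟩
  have : Mono (ι j) := (h j).mono_f
  have hι : ι (j + 1) ≫ (splice w).d (j + 1) j = 0 := by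
    rw [splice_d, reassoc_of% w (j + 1), zero_comp]
  have hker : IsLimit (KernelFork.ofι (ι (j + 1)) hι) :=
    isKernelCompMono (h (j + 1)).fIsKernel (ι j) (splice_d (w := w) j)
  exact ⟨((splice w).cyclesIsKernel (j + 1) j (by simp)).conePointUniqueUpToIso hker⟩

/-- The direct sum of the disks `⋯ ⟶ 0 ⟶ N_n ⟶ N_n ⟶ 0 ⟶ ⋯`, where the left copy of `N_n` is in
degree `n`. -/
noncomputable abbrev disks (N : ℤ → A) : ChainComplex A ℤ :=
  splice (L := fun n => N n ⊞ N (n + 1)) (ι := fun _ => biprod.inr) (π := fun _ => biprod.fst)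
    fun _ => biprod.inr_fst

lemma shortExact_inr_fst (X Y : A) :
    (ShortComplex.mk (biprod.inr : Y ⟶ X ⊞ Y) biprod.fst biprod.inr_fst).ShortExact where
  exact := ShortComplex.exact_of_f_is_kernel _ (biprod.isKernelFstKernelFork X Y)

lemma disks_d (N : ℤ → A) (n : ℤ) : (disks N).d (n + 1) n = biprod.fst ≫ biprod.inr :=
  splice_d n

lemma acyclic_disks (N : ℤ → A) : (disks N).Acyclic := fun i => by
  obtain ⟨n, rfl⟩ : ∃ n, i = n + 1 := ⟨i - 1, by omega⟩
  exact exactAt_splice (fun n => shortExact_inr_fst (N n) (N (n + 1))) n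

lemma nonempty_cycles_disks_iso (N : ℤ → A) (n : ℤ) :
    Nonempty ((disks N).cycles n ≅ N (n + 1)) :=
  nonempty_cycles_splice_iso (fun n => shortExact_inr_fst (N n) (N (n + 1))) n

/-- The morphism `disks N ⟶ K` which corresponds to a family of morphisms `N n ⟶ K.X n`. -/
noncomputable def disksDesc {N : ℤ → A} {K : ChainComplex A ℤ} (f : ∀ n, N n ⟶ K.X n) :
    disks N ⟶ K where
  f n := biprod.desc (f n) (f (n + 1) ≫ K.d (n + 1) n)
  comm' i j hij := by
    obtain rfl : j + 1 = i := hij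
    rw [disks_d]
    ext <;> simp

lemma disksDesc_f {N : ℤ → A} {K : ChainComplex A ℤ} (f : ∀ n, N n ⟶ K.X n) (n : ℤ) :
    (disksDesc f).f n = biprod.desc (f n) (f (n + 1) ≫ K.d (n + 1) n) := rfl

lemma disks_hom_ext {N : ℤ → A} {K : ChainComplex A ℤ} {f g : disks N ⟶ K}
    (h : ∀ n, biprod.inl ≫ f.f n = biprod.inl ≫ g.f n) : f = g := by
  have inr_f (f : disks N ⟶ K) (n : ℤ) :
      biprod.inr ≫ f.f n = (biprod.inl ≫ f.f (n + 1)) ≫ K.d (n + 1) n := by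
    rw [Category.assoc, f.comm, disks_d]
    simp
  ext n : 1
  exact biprod.hom_ext' _ _ (h n) (by rw [inr_f, inr_f, h])

/-- The functoriality of `disks N` in `N`, by which degreewise short exact sequences become short
exact sequences of complexes. -/
noncomputable def disksMap {N N' : ℤ → A} (f : ∀ n, N n ⟶ N' n) : disks N ⟶ disks N' where
  f n := biprod.map (f n) (f (n + 1))
  comm' i j hij := by
    obtain rfl : j + 1 = i := hij
    rw [disks_d, disks_d]
    ext <;> simp

lemma disksMap_comp_eq_zero {X Y Z : ℤ → A} {i : ∀ n, X n ⟶ Y n} {p : ∀ n, Y n ⟶ Z n}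
    (w : ∀ n, i n ≫ p n = 0) : disksMap i ≫ disksMap p = 0 := by
  ext n : 1
  change biprod.map (i n) (i (n + 1)) ≫ biprod.map (p n) (p (n + 1)) = 0
  ext <;> simp [w]

lemma shortExact_disksMap {X Y Z : ℤ → A} {i : ∀ n, X n ⟶ Y n} {p : ∀ n, Y n ⟶ Z n}
    {w : ∀ n, i n ≫ p n = 0} (h : ∀ n, (ShortComplex.mk (i n) (p n) (w n)).ShortExact) :
    (ShortComplex.mk (disksMap i) (disksMap p) (disksMap_comp_eq_zero w)).ShortExact :=
  HomologicalComplex.shortExact_of_degreewise_shortExact _ fun n =>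
    shortExact_biprodMap (h n) (h (n + 1))

lemma projective_disks {N : ℤ → A} (hN : ∀ n, Projective (N n)) : Projective (disks N) where
  factors {E X} f e _ := by
    refine ⟨disksDesc fun n => Projective.factorThru (biprod.inl ≫ f.f n) (e.f n),
      disks_hom_ext fun n => ?_⟩
    rw [HomologicalComplex.comp_f, disksDesc_f, biprod.inl_desc_assoc, Projective.factorThru_comp]

lemma extVanishing_disks [HasExt.{t} A] [EnoughProjectives A] [HasExt.{t'} (ChainComplex A ℤ)]
    {N : ℤ → A} {K : ChainComplex A ℤ} (h : ∀ n, ExtVanishing (N n) (K.X n)) :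
    ExtVanishing (disks N) K := by
  refine ExtVanishing.of_syzygies
    (fun E => ∃ N : ℤ → A, E = disks N ∧ ∀ n, ExtVanishing (N n) (K.X n)) ?_ ⟨N, rfl, h⟩
  rintro _ ⟨N, rfl, h⟩
  have hs (n : ℤ) := shortExact_kernel (Projective.π (N n))
  have := projective_disks (N := fun n => Projective.over (N n)) fun n => inferInstance
  refine ⟨_, _, _, _, _, shortExact_disksMap hs, ExtVanishing.of_projective _ _,
    ⟨_, rfl, fun n => .X₁_of_shortExact (hs n) (.of_projective _ _) (h n)⟩, fun φ => ?_⟩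
  choose ψ hψ using fun n => (h n).exists_f_comp_eq (hs n) (biprod.inl ≫ φ.f n)
  refine ⟨disksDesc ψ, disks_hom_ext fun n => ?_⟩
  rw [← hψ, HomologicalComplex.comp_f, disksDesc_f]
  simp [disksMap]

lemma exists_epi_from_disks [EnoughProjectives A] (K : ChainComplex A ℤ) :
    ∃ (N : ℤ → A) (π : disks N ⟶ K), (∀ n, Projective (N n)) ∧ Epi π := by
  let π : disks (fun n => Projective.over (K.X n)) ⟶ K := disksDesc fun n => Projective.π (K.X n)
  have (n : ℤ) : Epi (π.f n) := by
    have h : biprod.inl ≫ π.f n = Projective.π (K.X n) := by rw [disksDesc_f, biprod.inl_desc]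
    exact epi_of_epi_fac h
  exact ⟨_, π, fun n => inferInstance, HomologicalComplex.epi_of_epi_f π this⟩

variable {K : ChainComplex A ℤ}

lemma mono_fromOpcycles (hK : K.Acyclic) (n : ℤ) : Mono (K.fromOpcycles (n + 1) n) :=
  Preadditive.mono_of_isZero_kernel' _ (K.homologyIsKernel (n + 1) n (by simp))
    ((K.exactAt_iff_isZero_homology _).1 (hK _))

lemma shortExact_opcycles (hK : K.Acyclic) (n : ℤ) :
    (ShortComplex.mk (K.fromOpcycles (n + 1) n) (K.pOpcycles n)
      (by simp [← cancel_epi (K.pOpcycles (n + 1))])).ShortExact where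
  exact := (exact_iff_of_epi_mono_fac (K.p_fromOpcycles (n + 1) n) (Category.comp_id _)).1
    ((ShortComplex.mk _ _ (K.d_pOpcycles (n + 1) n)).exact_of_g_is_cokernel
      (K.opcyclesIsCokernel (n + 1) n (by simp)))
  mono_f := mono_fromOpcycles hK n

lemma isIso_opcyclesToCycles (hK : K.Acyclic) (n : ℤ) : IsIso (K.opcyclesToCycles (n + 1) n) := by
  have := mono_fromOpcycles hK n
  have := mono_of_mono_fac (K.opcyclesToCycles_iCycles (n + 1) n)
  have : Epi (K.toCycles (n + 1) n) :=
    Preadditive.epi_of_isZero_cokernel' _ (K.homologyIsCokernel (n + 1) n (by simp))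
      ((K.exactAt_iff_isZero_homology _).1 (hK n))
  have := epi_of_epi_fac (K.pOpcycles_opcyclesToCycles (n + 1) n)
  exact isIso_of_mono_of_epi _

lemma exists_section_pOpcycles [HasExt.{t} A] (hK : K.Acyclic) (n : ℤ)
    (h : ExtVanishing (K.opcycles n) (K.opcycles (n + 1))) :
    ∃ s : K.opcycles n ⟶ K.X n, s ≫ K.pOpcycles n = 𝟙 _ := by
  have hS := shortExact_opcycles hK n
  obtain ⟨r, hr⟩ := h.exists_f_comp_eq hS (𝟙 _)
  exact ⟨_, (ShortComplex.Splitting.ofExactOfRetraction _ hS.exact r hr hS.epi_g).s_g⟩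

lemma nonempty_disks_iso [HasExt.{t} A] (hK : K.Acyclic)
    (h : ∀ n, ExtVanishing (K.opcycles n) (K.opcycles (n + 1))) :
    Nonempty (disks (fun n => K.opcycles n) ≅ K) := by
  choose s hs using fun n => exists_section_pOpcycles hK n (h n)
  have (n : ℤ) : IsIso ((disksDesc s).f n) := by
    rw [disksDesc_f, ← K.p_fromOpcycles, reassoc_of% (hs (n + 1))]
    exact isIso_biprod_desc (shortExact_opcycles hK n) (hs n)
  have := HomologicalComplex.Hom.isIso_of_components (disksDesc s)
  exact ⟨asIso (disksDesc s)⟩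

end Disks

section LinearAlgebra

open TensorProduct LinearMap

variable {R : Type u} [CommRing R] {C F K P M N Z : Type*} [AddCommGroup C] [Module R C]
  [AddCommGroup F] [Module R F] [AddCommGroup K] [Module R K] [AddCommGroup P] [Module R P]
  [AddCommGroup M] [Module R M] [AddCommGroup N] [Module R N] [AddCommGroup Z] [Module R Z]
  {i : K →ₗ[R] P} {p : P →ₗ[R] M}

variable (R C F N) in
/-- The natural map `Hom(N, C) ⊗ F → Hom(N, C ⊗ F)`, which relates extension problems into `C ⊗ F`
to extension problems into `C`. -/
abbrev homTensor : (N →ₗ[R] C) ⊗[R] F →ₗ[R] (N →ₗ[R] C ⊗[R] F) :=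
  rTensorHomToHomRTensor (.id R) N C F

lemma homTensor_rTensor_lcomp (f : M →ₗ[R] N) (x : (N →ₗ[R] C) ⊗[R] F) :
    homTensor R C F M ((lcomp R C f).rTensor F x) = homTensor R C F N x ∘ₗ f := by
  induction x with
  | zero => simp
  | add x y hx hy => simp only [map_add, hx, hy, add_comp]
  | tmul α y => ext m; simp

lemma homTensor_bijective_of_projective [Module.Finite R P] [Module.Projective R P] :
    Function.Bijective (homTensor R C F P) := by
  rw [homTensor, ← rTensorHomEquivHomRTensor_toLinearMap]
  exact (rTensorHomEquivHomRTensor R P C F).bijective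

lemma homTensor_injective [Module.Flat R F] [Module.Finite R P] [Module.Projective R P]
    (hp : Function.Surjective p) : Function.Injective (homTensor R C F M) := by
  have hp' : Function.Injective ((lcomp R C p).rTensor F) :=
    Module.Flat.rTensor_preserves_injective_linearMap _ (lcomp_injective_of_surjective p hp)
  refine .of_comp (f := lcomp R (C ⊗[R] F) p) ?_
  convert (homTensor_bijective_of_projective (P := P)).1.comp hp' using 1
  exact funext fun x => (homTensor_rTensor_lcomp p x).symm

lemma homTensor_bijective [Module.Flat R F] [Module.Finite R P] [Module.Projective R P]
    (hp : Function.Surjective p) (hip : Function.Exact i p)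
    (hK : Function.Injective (homTensor R C F K)) : Function.Bijective (homTensor R C F M) := by
  refine ⟨homTensor_injective hp, fun φ => ?_⟩
  obtain ⟨y, hy⟩ := (homTensor_bijective_of_projective (R := R)).2 (φ ∘ₗ p)
  have hy₀ : (lcomp R C i).rTensor F y = 0 := hK <| by
    rw [homTensor_rTensor_lcomp, hy, comp_assoc, hip.linearMap_comp_eq_zero, LinearMap.comp_zero,
      map_zero]
  obtain ⟨x, rfl⟩ := (Module.Flat.rTensor_exact F
    (exact_lcomp_of_exact_of_surjective C hip hp) y).1 hy₀
  rw [homTensor_rTensor_lcomp] at hy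
  exact ⟨x, (LinearMap.cancel_right hp).1 hy⟩

lemma flip_mk_bijective (hC : Function.Bijective (LinearMap.lsmul R C))
    (hC' : Function.Bijective (homTensor R C F C)) :
    Function.Bijective (TensorProduct.mk R C F).flip := by
  let e := (TensorProduct.lid R F).symm ≪≫ₗ (LinearEquiv.ofBijective _ hC).rTensor F ≪≫ₗ
    LinearEquiv.ofBijective _ hC'
  convert e.bijective using 1
  ext y c
  simp [e]

variable (R C F M) in
/-- The natural map `M ⊗ F → Hom(Hom(M, C), C ⊗ F)`. It is an isomorphism for the syzygies of a
semidualizing module `C`, which shows that `Ext` from their `C`-duals into `C ⊗ F` vanishes. -/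
noncomputable abbrev biduality : M ⊗[R] F →ₗ[R] ((M →ₗ[R] C) →ₗ[R] C ⊗[R] F) :=
  (rTensorHom F).flip

lemma biduality_apply (y : M ⊗[R] F) (α : M →ₗ[R] C) :
    biduality R C F M y α = α.rTensor F y := rfl

lemma biduality_rTensor (f : M →ₗ[R] N) (y : M ⊗[R] F) :
    biduality R C F N (f.rTensor F y) = biduality R C F M y ∘ₗ lcomp R C f := by
  ext α : 1
  exact (rTensor_comp_apply F α f y).symm

lemma biduality_self_bijective (hC : Function.Bijective (LinearMap.lsmul R C)) :
    Function.Bijective (biduality R C F C) := by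
  refine ⟨(injective_iff_map_eq_zero _).2 fun y hy => ?_, fun φ => ⟨φ LinearMap.id, ?_⟩⟩
  · simpa [biduality_apply] using congr($hy LinearMap.id)
  · ext α : 1
    obtain ⟨r, rfl⟩ := hC.2 α
    have hr : lsmul R C r = r • LinearMap.id := rfl
    rw [hr, map_smul, map_smul, biduality_apply, rTensor_id, LinearMap.id_apply]

/-- `Hom(P, C) ≅ C ⊗ P^*` for finitely generated projective `P`, by which `C`-duals of such modules
are `C`-projective. -/
noncomputable def homEquivTensorDual (C P : Type*) [AddCommGroup C] [Module R C]
    [AddCommGroup P] [Module R P] [Module.Finite R P] [Module.Projective R P] :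
    (P →ₗ[R] C) ≃ₗ[R] C ⊗[R] Module.Dual R P :=
  (dualTensorHomEquiv R P C).symm ≪≫ₗ TensorProduct.comm R _ _

-- Both sides are naturally `Hom(P^*, F)`: use `P ≅ P^**` on the left and
-- `Hom(P, C) ≅ P^* ⊗ C`, `F ≅ Hom(C, C ⊗ F)` on the right.
lemma biduality_bijective_of_projective [Module.Finite R P] [Module.Projective R P]
    (hC : Function.Bijective (TensorProduct.mk R C F).flip) :
    Function.Bijective (biduality R C F P) := by
  let e : P ⊗[R] F ≃ₗ[R] ((P →ₗ[R] C) →ₗ[R] C ⊗[R] F) :=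
    (Module.evalEquiv R P).rTensor F ≪≫ₗ dualTensorHomEquiv R (Module.Dual R P) F ≪≫ₗ
      (LinearEquiv.ofBijective _ hC).congrRight ≪≫ₗ
      TensorProduct.lift.equiv (.id R) (Module.Dual R P) C (C ⊗[R] F) ≪≫ₗ
      (dualTensorHomEquiv R P C).arrowCongr (.refl R _)
  suffices h : biduality R C F P = e.toLinearMap by rw [h]; exact e.bijective
  ext x y α
  obtain ⟨t, rfl⟩ := (dualTensorHomEquiv R P C).surjective α
  induction t with
  | zero => simp
  | add t t' ht ht' => rw [map_add, map_add, map_add, ht, ht']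
  | tmul ξ c => simp [e, smul_tmul, LinearEquiv.congrRight]

lemma biduality_bijective_left [Module.Flat R F] (hi : Function.Injective i)
    (hp : Function.Surjective p) (hip : Function.Exact i p)
    (hi' : Function.Surjective (lcomp R C i)) (hP : Function.Bijective (biduality R C F P))
    (hM : Function.Injective (biduality R C F M)) : Function.Bijective (biduality R C F K) := by
  constructor
  · have hi₀ := Module.Flat.rTensor_preserves_injective_linearMap (M := F) i hi
    refine .of_comp (f := lcomp R (C ⊗[R] F) (lcomp R C i)) ?_
    convert hP.1.comp hi₀ using 1
    exact funext fun y => (biduality_rTensor i y).symm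
  · intro φ
    obtain ⟨z, hz⟩ := hP.2 (φ ∘ₗ lcomp R C i)
    have hz₀ : p.rTensor F z = 0 := hM <| by
      rw [biduality_rTensor, hz, comp_assoc,
        (exact_lcomp_of_exact_of_surjective C hip hp).linearMap_comp_eq_zero, LinearMap.comp_zero,
        map_zero]
    obtain ⟨y, rfl⟩ := (_root_.rTensor_exact F hip hp z).1 hz₀
    rw [biduality_rTensor] at hz
    exact ⟨y, (LinearMap.cancel_right hi').1 hz⟩

lemma exists_comp_lcomp_eq_of_biduality (hp : Function.Surjective p)
    (hM : Function.Surjective (biduality R C F M)) (φ : (M →ₗ[R] C) →ₗ[R] C ⊗[R] F) :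
    ∃ ψ : (P →ₗ[R] C) →ₗ[R] C ⊗[R] F, ψ ∘ₗ lcomp R C p = φ := by
  obtain ⟨y, rfl⟩ := hM φ
  obtain ⟨z, rfl⟩ := rTensor_surjective F hp y
  exact ⟨biduality R C F P z, (biduality_rTensor p z).symm⟩

lemma exists_comp_rTensor_eq [Module.Projective R Z]
    (hi : ∀ φ : K →ₗ[R] N, ∃ ψ : P →ₗ[R] N, ψ ∘ₗ i = φ) (φ : K ⊗[R] Z →ₗ[R] N) :
    ∃ ψ : P ⊗[R] Z →ₗ[R] N, ψ ∘ₗ i.rTensor Z = φ := by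
  obtain ⟨ψ, hψ⟩ := Module.projective_lifting_property (lcomp R N i)
    ((TensorProduct.mk R K Z).flip.compr₂ φ) hi
  refine ⟨TensorProduct.lift ψ.flip, ?_⟩
  ext k z
  simpa using congr($hψ z k)

end LinearAlgebra

section Modules

open TensorProduct

variable {R : Type u} [CommRing R] {S : ShortComplex (ModuleCat.{u} R)}

lemma function_exact_of_shortExact (hS : S.ShortExact) : Function.Exact S.f.hom S.g.hom :=
  (ShortComplex.ShortExact.moduleCat_exact_iff_function_exact S).1 hS.exact

lemma shortExact_rTensor (hS : S.ShortExact) (F : Type u) [AddCommGroup F] [Module R F]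
    [Module.Flat R F] :
    (ShortComplex.moduleCatMk (S.f.hom.rTensor F) (S.g.hom.rTensor F)
      (rTensor_exact F (function_exact_of_shortExact hS)
        hS.moduleCat_surjective_g).linearMap_comp_eq_zero).ShortExact :=
  ModuleCat.shortComplex_shortExact _
    (rTensor_exact F (function_exact_of_shortExact hS) hS.moduleCat_surjective_g)
    (Module.Flat.rTensor_preserves_injective_linearMap _ hS.moduleCat_injective_f)
    (LinearMap.rTensor_surjective F hS.moduleCat_surjective_g)

lemma ExtVanishing.exists_linearMap_comp_eq {T : ModuleCat.{u} R} (hS : S.ShortExact)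
    (h₃ : ExtVanishing S.X₃ T) (φ : S.X₁ →ₗ[R] T) :
    ∃ ψ : S.X₂ →ₗ[R] T, ψ ∘ₗ S.f.hom = φ := by
  obtain ⟨ψ, hψ⟩ := h₃.exists_f_comp_eq hS (ModuleCat.ofHom φ)
  exact ⟨ψ.hom, congr($(hψ).hom)⟩

lemma lcomp_exact_of_shortExact (hS : S.ShortExact) (C : ModuleCat.{u} R) :
    Function.Exact (LinearMap.lcomp R C S.g.hom) (LinearMap.lcomp R C S.f.hom) :=
  LinearMap.exact_lcomp_of_exact_of_surjective C (function_exact_of_shortExact hS)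
    hS.moduleCat_surjective_g

lemma shortExact_lcomp (hS : S.ShortExact) {C : ModuleCat.{u} R} (h₃ : ExtVanishing S.X₃ C) :
    (ShortComplex.moduleCatMk (LinearMap.lcomp R C S.g.hom) (LinearMap.lcomp R C S.f.hom)
      (lcomp_exact_of_shortExact hS C).linearMap_comp_eq_zero).ShortExact :=
  ModuleCat.shortComplex_shortExact _ (lcomp_exact_of_shortExact hS C)
    (LinearMap.lcomp_injective_of_surjective _ hS.moduleCat_surjective_g)
    (h₃.exists_linearMap_comp_eq hS)

lemma ExtVanishing.rTensor {K M : ModuleCat.{u} R} (h : ExtVanishing K M) (Z : Type u)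
    [AddCommGroup Z] [Module R Z] [Module.Projective R Z] :
    ExtVanishing (ModuleCat.of R (K ⊗[R] Z)) M := by
  refine .of_syzygies
    (fun N => ∃ K : ModuleCat.{u} R, ExtVanishing K M ∧ N = ModuleCat.of R (K ⊗[R] Z)) ?_
    ⟨K, h, rfl⟩
  rintro _ ⟨K, h, rfl⟩
  obtain ⟨⟨E, π⟩⟩ := EnoughProjectives.presentation K
  have hS := shortExact_kernel π
  have : Module.Projective R E := (IsProjective.iff_projective E).2 inferInstance
  have : Projective (ModuleCat.of R (E ⊗[R] Z)) := (IsProjective.iff_projective _).1 inferInstance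
  refine ⟨_, _, _, _, _, shortExact_rTensor hS Z, .of_projective _ _,
    ⟨_, .X₁_of_shortExact hS (.of_projective _ _) h, rfl⟩, fun φ => ?_⟩
  obtain ⟨ψ, hψ⟩ := exists_comp_rTensor_eq (h.exists_linearMap_comp_eq hS) φ.hom
  exact ⟨ModuleCat.ofHom ψ, ModuleCat.hom_ext hψ⟩

/-- The class of finitely generated projective modules, the terms of the resolution of a
semidualizing module. -/
def finiteProjectiveModules (R : Type u) [CommRing R] : ObjectProperty (ModuleCat.{u} R) :=
  fun P => Module.Finite R P ∧ Module.Projective R P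

/-- The class of modules of type `FP_∞`, i.e. of modules which have a resolution by finitely
generated projective modules. It is the largest class of modules every member of which is a quotient
of a finitely generated projective module by a member of the class. -/
def IsFPInfty : ObjectProperty (ModuleCat.{u} R) := fun M =>
  ∃ 𝒮 : ObjectProperty (ModuleCat.{u} R),
    𝒮 M ∧ ∀ N, 𝒮 N → ∃ K, IsSyzygy (finiteProjectiveModules R) K N ∧ 𝒮 K

namespace IsFPInfty

variable {M : ModuleCat.{u} R}

lemma exists_syzygy (h : IsFPInfty M) :
    ∃ K, IsSyzygy (finiteProjectiveModules R) K M ∧ IsFPInfty K := by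
  obtain ⟨𝒮, hM, h𝒮⟩ := h
  obtain ⟨K, hKM, hK⟩ := h𝒮 M hM
  exact ⟨K, hKM, 𝒮, hK, h𝒮⟩

lemma of_projectiveResolution (P : ProjectiveResolution M)
    (hP : ∀ n, Module.Finite R (P.complex.X n)) : IsFPInfty M := by
  have hP' (n : ℕ) : finiteProjectiveModules R (P.complex.X n) :=
    ⟨hP n, (IsProjective.iff_projective _).2 (P.projective n)⟩
  refine ⟨fun N => N = M ∨ ∃ k, N = Abelian.image (P.complex.d (k + 1) k), Or.inl rfl, ?_⟩
  rintro N (rfl | ⟨k, rfl⟩)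
  · have hπ : Epi (P.π.f 0) := inferInstance
    have : Epi (Abelian.image.ι (P.π.f 0)) := epi_of_epi_fac (Abelian.image.fac (P.π.f 0))
    have hι : IsIso (Abelian.image.ι (P.π.f 0)) := isIso_of_mono_of_epi _
    exact ⟨_, (isSyzygy_of_shortExact (shortExact_image P.exact₀) (hP' 0)).of_iso_right
      (@asIso _ _ _ _ _ hι), Or.inr ⟨0, rfl⟩⟩
  · exact ⟨_, isSyzygy_of_shortExact (shortExact_image (P.exact_succ k)) (hP' (k + 1)),
      Or.inr ⟨k + 1, rfl⟩⟩

lemma homTensor_injective (h : IsFPInfty M) (C F : Type u) [AddCommGroup C] [Module R C]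
    [AddCommGroup F] [Module R F] [Module.Flat R F] :
    Function.Injective (homTensor R C F M) := by
  obtain ⟨K, ⟨P, i, p, w, hS, hP, hP'⟩, -⟩ := h.exists_syzygy
  exact DingC.homTensor_injective hS.moduleCat_surjective_g

lemma homTensor_bijective (h : IsFPInfty M) (C F : Type u) [AddCommGroup C] [Module R C]
    [AddCommGroup F] [Module R F] [Module.Flat R F] :
    Function.Bijective (homTensor R C F M) := by
  obtain ⟨K, ⟨P, i, p, w, hS, hP, hP'⟩, hK⟩ := h.exists_syzygy
  exact DingC.homTensor_bijective hS.moduleCat_surjective_g (function_exact_of_shortExact hS)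
    (hK.homTensor_injective C F)

lemma extVanishing_tensor (h : IsFPInfty M) {C : ModuleCat.{u} R} (hC : ExtVanishing M C)
    (F : Type u) [AddCommGroup F] [Module R F] [Module.Flat R F] :
    ExtVanishing M (ModuleCat.of R (C ⊗[R] F)) := by
  refine .of_syzygies (fun M => IsFPInfty M ∧ ExtVanishing M C) ?_ ⟨h, hC⟩
  rintro M ⟨h, hC⟩
  obtain ⟨K, ⟨P, i, p, w, hS, _, hP⟩, hK⟩ := h.exists_syzygy
  have : Projective P := (IsProjective.iff_projective P).1 hP
  refine ⟨K, P, i, p, w, hS, .of_projective _ _,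
    ⟨hK, .X₁_of_shortExact hS (.of_projective _ _) hC⟩, fun φ => ?_⟩
  obtain ⟨y, hy⟩ := (hK.homTensor_bijective C F).2 φ.hom
  obtain ⟨z, rfl⟩ := LinearMap.rTensor_surjective F
    (show Function.Surjective (LinearMap.lcomp R C i.hom) from hC.exists_linearMap_comp_eq hS) y
  refine ⟨ModuleCat.ofHom (homTensor R C F P z), ModuleCat.hom_ext ?_⟩
  rw [← hy, homTensor_rTensor_lcomp]
  rfl

end IsFPInfty

/-- The modules `M` of type `FP_∞` for which `Ext^n(M, C) = 0`, `Ext^n(Hom(M, C), C ⊗ F) = 0` and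
`M ⊗ F ≅ Hom(Hom(M, C), C ⊗ F)` for all flat modules `F` and all `n ≥ 1`. If `C` is semidualizing,
this class contains `C` and its syzygies. -/
structure IsBidual (C M : ModuleCat.{u} R) : Prop where
  isFPInfty : IsFPInfty M
  extVanishing : ExtVanishing M C
  biduality_bijective : ∀ (F : Type u) [AddCommGroup F] [Module R F] [Module.Flat R F],
    Function.Bijective (biduality R C F M)
  extVanishing_dual : ∀ (F : Type u) [AddCommGroup F] [Module R F] [Module.Flat R F],
    ExtVanishing (ModuleCat.of R (M →ₗ[R] C)) (ModuleCat.of R (C ⊗[R] F))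

namespace IsSemidualizing

variable {C : ModuleCat.{u} R} (hC : IsSemidualizing C)

include hC

lemma isFPInfty : IsFPInfty C := by
  obtain ⟨P, hP⟩ := hC.finite_resolution
  exact .of_projectiveResolution P hP

lemma extVanishing : ExtVanishing C C := fun n => hC.ext_eq_zero (n + 1) (by omega)

lemma extVanishing_tensor_tensor (P F : Type u) [AddCommGroup P] [Module R P]
    [Module.Projective R P] [AddCommGroup F] [Module R F] [Module.Flat R F] :
    ExtVanishing (ModuleCat.of R (C ⊗[R] P)) (ModuleCat.of R (C ⊗[R] F)) :=
  (hC.isFPInfty.extVanishing_tensor hC.extVanishing F).rTensor P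

lemma isBidual_self : IsBidual C C where
  isFPInfty := hC.isFPInfty
  extVanishing := hC.extVanishing
  biduality_bijective F _ _ _ := biduality_self_bijective hC.homothety
  extVanishing_dual F _ _ _ := by
    have : Projective (ModuleCat.of R (C →ₗ[R] C)) := (IsProjective.iff_projective _).1
      (Module.Projective.of_equiv (LinearEquiv.ofBijective _ hC.homothety))
    exact .of_projective _ _

lemma isBidual_X₁_of_shortExact (hS : S.ShortExact) (hP : finiteProjectiveModules R S.X₂)
    (h₁ : IsFPInfty S.X₁) (h₃ : IsBidual C S.X₃) : IsBidual C S.X₁ where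
  isFPInfty := h₁
  extVanishing := by
    have := (IsProjective.iff_projective S.X₂).1 hP.2
    exact .X₁_of_shortExact hS (.of_projective _ _) h₃.extVanishing
  biduality_bijective F _ _ _ := by
    obtain ⟨_, _⟩ := hP
    have hF := flip_mk_bijective hC.homothety (hC.isFPInfty.homTensor_bijective C F)
    exact biduality_bijective_left hS.moduleCat_injective_f hS.moduleCat_surjective_g
      (function_exact_of_shortExact hS) (h₃.extVanishing.exists_linearMap_comp_eq hS)
      (biduality_bijective_of_projective hF) (h₃.biduality_bijective F).1
  extVanishing_dual F _ _ _ := by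
    obtain ⟨_, _⟩ := hP
    refine .X₃_of_shortExact (shortExact_lcomp hS h₃.extVanishing) (h₃.extVanishing_dual F)
      ((hC.extVanishing_tensor_tensor (Module.Dual R S.X₂) F).of_iso
        (homEquivTensorDual C S.X₂).symm.toModuleIso) fun φ => ?_
    obtain ⟨ψ, hψ⟩ := exists_comp_lcomp_eq_of_biduality hS.moduleCat_surjective_g
      (h₃.biduality_bijective F).2 φ.hom
    exact ⟨ModuleCat.ofHom ψ, ModuleCat.hom_ext hψ⟩

end IsSemidualizing

end Modules

section Tilde

open TensorProduct

universe t

lemma nonempty_map_biprod_iso {A B : Type*} [Category* A] [Category* B] [Abelian A] [Abelian B]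
    (F : A ⥤ B) [F.Additive] (X Y : A) : Nonempty (F.obj (X ⊞ Y) ≅ F.obj X ⊞ F.obj Y) := by
  have := preservesBinaryBiproducts_of_preservesBiproducts F
  exact ⟨F.mapBiprod X Y⟩

instance {A : Type w} [Category.{v} A] [Abelian A] {ι : Type*} (c : ComplexShape ι) (i : ι) :
    (HomologicalComplex.cyclesFunctor A c i).Additive where
  map_add {_ _ f g} := ShortComplex.cyclesMap_add
    ((HomologicalComplex.shortComplexFunctor A c i).map f)
    ((HomologicalComplex.shortComplexFunctor A c i).map g)

lemma acyclic_biprod {A : Type w} [Category.{v} A] [Abelian A] {ι : Type*} {c : ComplexShape ι}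
    {X Y : HomologicalComplex A c} (hX : X.Acyclic) (hY : Y.Acyclic) : (X ⊞ Y).Acyclic := by
  intro i
  obtain ⟨e⟩ := nonempty_map_biprod_iso (HomologicalComplex.homologyFunctor A c i) X Y
  exact (HomologicalComplex.exactAt_iff_isZero_homology _ _).2
    (((biprod_isZero_iff _ _).2 ⟨(hX i).isZero_homology, (hY i).isZero_homology⟩).of_iso e)

variable {R : Type u} [CommRing R]

section

variable {𝒳 : ObjectProperty (ModuleCat.{u} R)} [𝒳.IsClosedUnderIsomorphisms] {X Y : Ch R}

lemma tilde_biprod (h𝒳 : ∀ M N, 𝒳 M → 𝒳 N → 𝒳 (M ⊞ N)) (hX : tilde 𝒳 X) (hY : tilde 𝒳 Y) :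
    tilde 𝒳 (X ⊞ Y) := by
  refine ⟨acyclic_biprod hX.1 hY.1, fun i => ?_⟩
  obtain ⟨e⟩ := nonempty_map_biprod_iso
    (HomologicalComplex.cyclesFunctor (ModuleCat R) (ComplexShape.down ℤ) i) X Y
  exact 𝒳.prop_of_iso e.symm (h𝒳 _ _ (hX.2 i) (hY.2 i))

lemma tilde_disks {N : ℤ → ModuleCat.{u} R} (h : ∀ n, 𝒳 (N n)) : tilde 𝒳 (disks N) :=
  ⟨acyclic_disks N, fun n => 𝒳.prop_of_iso (nonempty_cycles_disks_iso N n).some.symm (h (n + 1))⟩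

lemma tilde_opcycles (h : tilde 𝒳 X) (n : ℤ) : 𝒳 (X.opcycles n) := by
  obtain ⟨k, rfl⟩ : ∃ k, n = k + 1 := ⟨n - 1, by omega⟩
  have := isIso_opcyclesToCycles h.1 k
  exact 𝒳.prop_of_iso (asIso (X.opcyclesToCycles (k + 1) k)).symm (h.2 k)

lemma exists_disks_iso (h𝒳 : ∀ M N, 𝒳 M → 𝒳 N → ExtVanishing M N) (h : tilde 𝒳 X) :
    ∃ N : ℤ → ModuleCat.{u} R, (∀ n, 𝒳 (N n)) ∧ Nonempty (disks N ≅ X) :=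
  ⟨fun n => X.opcycles n, tilde_opcycles h,
    nonempty_disks_iso h.1 fun _ => h𝒳 _ _ (tilde_opcycles h _) (tilde_opcycles h _)⟩

end

instance : (projectiveModules R).IsClosedUnderIsomorphisms where
  of_iso e h := by
    have : Module.Projective R _ := h
    exact Module.Projective.of_equiv e.toLinearEquiv

lemma exists_disks_iso_of_projective {X : Ch R} (h : tilde (projectiveModules R) X) :
    ∃ N : ℤ → ModuleCat.{u} R, (∀ n, projectiveModules R (N n)) ∧ Nonempty (disks N ≅ X) := by
  refine exists_disks_iso (fun M N hM _ => ?_) h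
  have : Projective M := (IsProjective.iff_projective M).1 hM
  exact .of_projective M N

lemma projective_of_tilde {X : Ch R} (h : tilde (projectiveModules R) X) : Projective X := by
  obtain ⟨N, hN, ⟨e⟩⟩ := exists_disks_iso_of_projective h
  exact Projective.of_iso e (projective_disks fun n => (IsProjective.iff_projective (N n)).1 (hN n))

lemma exists_epi_of_tilde_projective (X : Ch R) :
    ∃ (P : Ch R) (p : P ⟶ X), tilde (projectiveModules R) P ∧ Epi p := by
  obtain ⟨N, π, hN, hπ⟩ := exists_epi_from_disks X
  exact ⟨_, π, tilde_disks fun n => (IsProjective.iff_projective (N n)).2 (hN n), hπ⟩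

variable {C : ModuleCat.{u} R}

instance : (cProjectiveModules C).IsClosedUnderIsomorphisms where
  of_iso e := fun ⟨P, hP, ⟨e'⟩⟩ => ⟨P, hP, ⟨e.symm.toLinearEquiv ≪≫ₗ e'⟩⟩

instance : (cFlatModules C).IsClosedUnderIsomorphisms where
  of_iso e := fun ⟨F, hF, ⟨e'⟩⟩ => ⟨F, hF, ⟨e.symm.toLinearEquiv ≪≫ₗ e'⟩⟩

lemma cProjectiveModules_le_cFlatModules : cProjectiveModules C ≤ cFlatModules C :=
  fun _ ⟨P, _, e⟩ => ⟨P, inferInstance, e⟩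

lemma tilde_cProjective_le_tilde_cFlat :
    tilde (cProjectiveModules C) ≤ tilde (cFlatModules C) :=
  fun _ h => ⟨h.1, fun i => cProjectiveModules_le_cFlatModules _ (h.2 i)⟩

lemma cProjectiveModules_biprod {M N : ModuleCat.{u} R} (hM : cProjectiveModules C M)
    (hN : cProjectiveModules C N) : cProjectiveModules C (M ⊞ N) := by
  obtain ⟨P, hP, ⟨e⟩⟩ := hM
  obtain ⟨Q, hQ, ⟨e'⟩⟩ := hN
  exact ⟨ModuleCat.of R (P × Q), inferInstanceAs (Module.Projective R (P × Q)),
    ⟨(ModuleCat.biprodIsoProd M N).toLinearEquiv ≪≫ₗ LinearEquiv.prodCongr e e' ≪≫ₗ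
      (TensorProduct.prodRight R R C P Q).symm⟩⟩

lemma tilde_cProjective_biprod (X Y : Ch R) (hX : tilde (cProjectiveModules C) X)
    (hY : tilde (cProjectiveModules C) Y) : tilde (cProjectiveModules C) (X ⊞ Y) :=
  tilde_biprod (fun _ _ => cProjectiveModules_biprod) hX hY

lemma leftPerp_disks [HasExt.{t} (Ch R)] {N : ℤ → ModuleCat.{u} R}
    (h : ∀ n T, cFlatModules C T → ExtVanishing (N n) T) :
    leftPerp (tilde (cFlatModules C)) (disks N) := fun _ hT => extVanishing_disks fun n =>
  .X₂_of_shortExact_right (shortExact_opcycles hT.1 n) (h n _ (tilde_opcycles hT _))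
    (h n _ (tilde_opcycles hT _))

/-- The class of modules isomorphic to `Hom(M, C) ⊗ Z` with `M` bidual and `Z` projective. For a
semidualizing module `C` it contains the projective modules `Z ≅ Hom(C, C) ⊗ Z`, and its members
have coresolutions by `C`-projective modules with all cosyzygies in the class. -/
def dualTensorModules (C : ModuleCat.{u} R) : ObjectProperty (ModuleCat.{u} R) := fun N =>
  ∃ M Z : ModuleCat.{u} R, IsBidual C M ∧ Module.Projective R Z ∧
    Nonempty (N ≅ ModuleCat.of R ((M →ₗ[R] C) ⊗[R] Z))

lemma extVanishing_dualTensor_cFlat {N T : ModuleCat.{u} R}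
    (hN : dualTensorModules C N) (hT : cFlatModules C T) : ExtVanishing N T := by
  obtain ⟨M, Z, hM, hZ, ⟨e⟩⟩ := hN
  obtain ⟨F, hF, ⟨e'⟩⟩ := hT
  exact (((hM.extVanishing_dual F).rTensor Z).of_iso e.symm).of_iso_right e'.symm.toModuleIso

namespace IsSemidualizing

variable (hC : IsSemidualizing C)

include hC

lemma extVanishing_cProjective_cFlat {M N : ModuleCat.{u} R} (hM : cProjectiveModules C M)
    (hN : cFlatModules C N) : ExtVanishing M N := by
  obtain ⟨P, hP, ⟨e⟩⟩ := hM
  obtain ⟨F, hF, ⟨e'⟩⟩ := hN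
  exact ((hC.extVanishing_tensor_tensor P F).of_iso e.symm.toModuleIso).of_iso_right
    e'.symm.toModuleIso

lemma projectiveModules_le_dualTensorModules : projectiveModules R ≤ dualTensorModules C :=
  fun Z hZ => ⟨C, Z, hC.isBidual_self, hZ, ⟨((TensorProduct.lid R Z).symm ≪≫ₗ
    (LinearEquiv.ofBijective _ hC.homothety).rTensor Z).toModuleIso⟩⟩

lemma exists_isSyzygy_of_dualTensor {N : ModuleCat.{u} R} (hN : dualTensorModules C N) :
    ∃ N', IsSyzygy (cProjectiveModules C) N N' ∧ dualTensorModules C N' := by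
  obtain ⟨M, Z, hM, hZ, ⟨e⟩⟩ := hN
  obtain ⟨K, ⟨P, i, p, w, hS, hP⟩, hK⟩ := hM.isFPInfty.exists_syzygy
  obtain ⟨_, _⟩ := hP
  have hP : cProjectiveModules C (ModuleCat.of R ((P →ₗ[R] C) ⊗[R] Z)) :=
    ⟨ModuleCat.of R (Module.Dual R P ⊗[R] Z),
      inferInstanceAs (Module.Projective R (Module.Dual R P ⊗[R] Z)),
      ⟨(homEquivTensorDual C P).rTensor Z ≪≫ₗ TensorProduct.assoc R _ _ _⟩⟩
  exact ⟨_, (isSyzygy_of_shortExact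
      (shortExact_rTensor (shortExact_lcomp hS hM.extVanishing) Z) hP).of_iso_left e.symm,
    K, Z, hC.isBidual_X₁_of_shortExact hS ⟨‹_›, ‹_›⟩ hK hM, hZ, ⟨Iso.refl _⟩⟩

section Ext

variable [HasExt.{t} (Ch R)]

lemma leftPerp_of_tilde_cProjective :
    tilde (cProjectiveModules C) ≤ leftPerp (tilde (cFlatModules C)) := fun X hX => by
  obtain ⟨N, hN, ⟨e⟩⟩ := exists_disks_iso (fun _ _ hM hN =>
    hC.extVanishing_cProjective_cFlat hM (cProjectiveModules_le_cFlatModules _ hN)) hX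
  exact fun T hT => (leftPerp_disks (fun n _ => hC.extVanishing_cProjective_cFlat (hN n)) T
    hT).of_iso e

lemma coresolved_of_tilde_projective : tilde (projectiveModules R) ≤
    Coresolved (tilde (cProjectiveModules C)) (tilde (cFlatModules C)) := fun X hX => by
  obtain ⟨N, hN, ⟨e⟩⟩ := exists_disks_iso_of_projective hX
  refine Coresolved.of_iso ⟨fun Y => ∃ N, Y = disks N ∧ ∀ n, dualTensorModules C (N n),
    ⟨N, rfl, fun n => hC.projectiveModules_le_dualTensorModules _ (hN n)⟩, ?_⟩ e
  rintro _ ⟨N, rfl, hN⟩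
  choose N' hNN' hN' using fun n => hC.exists_isSyzygy_of_dualTensor (hN n)
  choose Q i p w hS hQ using hNN'
  exact ⟨leftPerp_disks fun n _ => extVanishing_dualTensor_cFlat (hN n), disks N',
    isSyzygy_of_shortExact (shortExact_disksMap hS) (tilde_disks hQ), N', rfl, hN'⟩

lemma dcProjective_eq : dcProjective C =
    Coresolved (tilde (cProjectiveModules C)) (tilde (cFlatModules C)) := by
  ext X
  refine ⟨coresolved_of_hasCompleteResolution (fun P hP T _ => ?_)
      hC.leftPerp_of_tilde_cProjective,
    hasCompleteResolution_of_coresolved exists_epi_of_tilde_projective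
      tilde_cProjective_le_tilde_cFlat tilde_cProjective_biprod hC.coresolved_of_tilde_projective⟩
  have := projective_of_tilde hP
  exact .of_projective P T

end Ext

lemma isResolving_dcProjective : IsResolving (dcProjective C) := by
  have := HasExt.standard (Ch R)
  rw [hC.dcProjective_eq]
  exact {
    X₂_of_shortExact := .X₂_of_shortExact tilde_cProjective_le_tilde_cFlat tilde_cProjective_biprod
    X₁_of_shortExact := .X₁_of_shortExact tilde_cProjective_le_tilde_cFlat tilde_cProjective_biprod
    exists_projective X := by
      obtain ⟨P, p, hP, hp⟩ := exists_epi_of_tilde_projective X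
      exact ⟨P, p, projective_of_tilde hP, hC.coresolved_of_tilde_projective P hP, hp⟩ }

end IsSemidualizing

end Tilde

end DingC

theorem corollary3p4 {R : Type u} [CommRing R] (C : ModuleCat.{u} R)
    (hC : DingC.IsSemidualizing C) (X Y Z : DingC.Ch R) (f : X ⟶ Y) (g : Y ⟶ Z)
    (w : f ≫ g = 0) (hS : (ShortComplex.mk f g w).ShortExact) :
    -- (1), with its consequences
    (∀ n : ℕ, DingC.dcPd C Z ≤ n → (DingC.dcPd C X ≤ n ↔ DingC.dcPd C Y ≤ n)) ∧
    DingC.dcPd C X ≤ max (DingC.dcPd C Y) (DingC.dcPd C Z) ∧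
    DingC.dcPd C Y ≤ max (DingC.dcPd C X) (DingC.dcPd C Z) ∧
    -- (2)
    (DingC.dcPd C Z < DingC.dcPd C X ∨ DingC.dcPd C Z < DingC.dcPd C Y →
      DingC.dcPd C X = DingC.dcPd C Y) ∧
    -- (3)
    (0 < DingC.dcPd C Z → DingC.dcProjective C Y →
      DingC.dcPd C X = DingC.dcPd C Z - 1) ∧
    -- two out of three
    (DingC.dcPd C X < ⊤ → DingC.dcPd C Y < ⊤ → DingC.dcPd C Z < ⊤) ∧
    (DingC.dcPd C X < ⊤ → DingC.dcPd C Z < ⊤ → DingC.dcPd C Y < ⊤) ∧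
    (DingC.dcPd C Y < ⊤ → DingC.dcPd C Z < ⊤ → DingC.dcPd C X < ⊤) := by
  have hD := hC.isResolving_dcProjective
  have hX := hD.resolutionDim_X₁_le_max hS
  have hY := hD.resolutionDim_X₂_le_max hS
  exact ⟨fun _ hZ => hD.resolutionDim_X₁_le_iff hS hZ, hX, hY, hD.resolutionDim_X₁_eq_X₂ hS,
    fun _ hY' => hD.resolutionDim_X₁_eq_sub_one hS hY', hD.resolutionDim_X₃_lt_top hS,
    fun hX' hZ' => hY.trans_lt (max_lt hX' hZ'), fun hY' hZ' => hX.trans_lt (max_lt hY' hZ')⟩
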